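/- Let $(\mathcal H,[\cdot,\cdot])$ be a Krein space: a complex vector space with a Hermitian sesquilinear form admitting a fundamental decomposition $\mathcal H=\mathcal H_+[\dotplus]\mathcal H_-$, i.e. a direct, $[\cdot,\cdot]$-orthogonal decomposition such that $(\mathcal H_+,[\cdot,\cdot])$ and $(\mathcal H_-,-[\cdot,\cdot])$ are Hilbert spaces; the topology of $\mathcal H$ is that of the resulting Hilbert space inner product $\langle\cdot,\cdot\rangle$. A subspace $\mathcal L$ is uniformly positive (negative) if for some $\alpha>0$ one has $[x,x]\ge\alpha\|x\|^2$ (respectively $-[x,x]\ge\alpha\|x\|^2$) for all $x\in\mathcal L$. A family $(f_i)_{i\in I}$ in $\mathcal H$ is Bessel if $\sum_{i\in I}|\langle x,f_i\rangle|^2\le\beta\|x\|^2$ for some $\beta$ and all $x$. Put $I_+=\{i:[f_i,f_i]\ge 0\}$ and $I_-=\{i:[f_i,f_i]<0\}$. A Bessel family is a $J$-frame if $\{\sum_{i\in I_+}c_if_i: c\in\ell_2(I)\}$ is a maximal uniformly positive subspace and $\{\sum_{i\in I_-}c_if_i: c\in\ell_2(I)\}$ is a maximal uniformly negative subspace; its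 $J$-frame operator is $Sx=\sum_{i\in I_+}[x,f_i]f_i-\sum_{i\in I_-}[x,f_i]f_i$. A bounded operator on a Hilbert space is uniformly positive if it is positive and boundedly invertible, and $W(T)=\{\langle Tx,x\rangle:\|x\|=1\}$ denotes the numerical range. Let $S$ be a $J$-frame operator in $(\mathcal H,[\cdot,\cdot])$. (i) Suppose that with respect to some fundamental decomposition $\mathcal H=\mathcal H_+[\dotplus]\mathcal H_-$ $$S=\begin{pmatrix}A&-AK\\K^*A&D\end{pmatrix},$$ where $A$ is uniformly positive in $\mathcal H_+$, $K:\mathcal H_-\to\mathcal H_+$ satisfies $\|K\|<1$, $D$ is self-adjoint in $\mathcal H_-$, and $D+K^*AK$ is uniformly positive in $\mathcal H_-$ (norms, adjoints and numerical ranges are taken in the Hilbert spaces $(\mathcal H_\pm,\pm[\cdot,\cdot])$). If $\overline{W(A)}=[a_-,a_+]$, $\overline{W(D)}=[d_-,d_+]$ and $\overline{W(D+K^*AK)}=[b_-,b_+]$ (in particular $\mathcal H_\pm\neq\{0\}$), then $$\sigma(S)\setminus\mathbb R\subseteq\Bigl\{\lambda\in\mathbb C:\ |\lambda-a_+|<a_+,\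 \operatorname{Re}\lambda>\tfrac{b_-}{2}\Bigr\},\qquad \sigma(S)\cap\mathbb R\subseteq\bigl[\min\{a_-,b_-\},\max\{a_+,d_+\}\bigr].$$ (ii) Suppose that with respect to some fundamental decomposition $\mathcal H=\mathcal K_+[\dotplus]\mathcal K_-$ $$S=\begin{pmatrix}A'&LD'\\-D'L^*&D'\end{pmatrix},$$ where $D'$ is uniformly positive in $\mathcal K_-$, $L:\mathcal K_-\to\mathcal K_+$ satisfies $\|L\|<1$, $A'$ is self-adjoint in $\mathcal K_+$, and $A'+LD'L^*$ is uniformly positive in $\mathcal K_+$. If $\overline{W(A')}=[a'_-,a'_+]$, $\overline{W(D')}=[d'_-,d'_+]$ and $\overline{W(A'+LD'L^*)}=[b'_-,b'_+]$ (in particular $\mathcal K_\pm\neq\{0\}$), then $$\sigma(S)\setminus\mathbb R\subseteq\Bigl\{\lambda\in\mathbb C:\ |\lambda-d'_+|<d'_+,\ \operatorname{Re}\lambda>\tfrac{b'_-}{2}\Bigr\},\qquad \sigma(S)\cap\mathbb R\subseteq\bigl[\min\{d'_-,b'_-\},\max\{a'_+,d'_+\}\bigr].$$ (iii) In particular, for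 every $J$-frame operator $S$ one has $\sigma(S)\subseteq\{\lambda\in\mathbb C:\operatorname{Re}\lambda>0\}$. -/

import Mathlib

open scoped InnerProduct

noncomputable section

namespace KreinFrame

section KreinSpace

variable {H : Type*} [NormedAddCommGroup H] [InnerProductSpace ℂ H] [CompleteSpace H]

/-- A fundamental symmetry: a unitary self-adjoint operator. A Krein space is a complex Hilbert
space together with a fundamental symmetry `J`; the indefinite inner product is `kreinForm J`. -/
structure IsFundamentalSymmetry (J : H →L[ℂ] H) : Prop where
  isSelfAdjoint : IsSelfAdjoint J
  sq_eq_one : J * J = 1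

/-- The indefinite inner product `[x, y] = ⟨J x, y⟩`, linear in `x` and conjugate-linear in `y`.
(Mathlib's `inner ℂ a b` is conjugate-linear in `a`, so that `⟨u, v⟩` reads `inner ℂ v u`.) -/
def kreinForm (J : H →L[ℂ] H) (x y : H) : ℂ := inner ℂ y (J x)

/-- A uniformly positive subspace: `[x, x] ≥ α ‖x‖²` on it, for some `α > 0`. -/
def IsUniformlyPositive (J : H →L[ℂ] H) (L : Submodule ℂ H) : Prop :=
  ∃ α : ℝ, 0 < α ∧ ∀ x ∈ L, α * ‖x‖ ^ 2 ≤ (kreinForm J x x).re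

/-- A uniformly negative subspace: `-[x, x] ≥ α ‖x‖²` on it, for some `α > 0`. -/
def IsUniformlyNegative (J : H →L[ℂ] H) (L : Submodule ℂ H) : Prop :=
  ∃ α : ℝ, 0 < α ∧ ∀ x ∈ L, α * ‖x‖ ^ 2 ≤ -(kreinForm J x x).re

end KreinSpace

section Frames

variable {H : Type*} [NormedAddCommGroup H] [InnerProductSpace ℂ H] [CompleteSpace H]
variable {ι : Type*}

/-- A Bessel family: `∑ᵢ |⟨x, fᵢ⟩|² ≤ β ‖x‖²` for all `x`. -/
def IsBessel (f : ι → H) : Prop :=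
  ∃ β : ℝ, ∀ x : H, Summable (fun i => ‖inner ℂ (f i) x‖ ^ 2) ∧
    ∑' i, ‖inner ℂ (f i) x‖ ^ 2 ≤ β * ‖x‖ ^ 2

/-- `I₊ = {i | [fᵢ, fᵢ] ≥ 0}`. -/
def posIndex (J : H →L[ℂ] H) (f : ι → H) : Set ι := {i | 0 ≤ (kreinForm J (f i) (f i)).re}

/-- `I₋ = {i | [fᵢ, fᵢ] < 0}`. -/
def negIndex (J : H →L[ℂ] H) (f : ι → H) : Set ι := {i | (kreinForm J (f i) (f i)).re < 0}

/-- The range of the synthesis operator `c ↦ ∑_{i ∈ s} cᵢ fᵢ` on `ℓ²(ι)`. With `s = I₊` and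
`s = I₋` these are the ranges of `T₊` and `T₋`. -/
def synthesisRange (f : ι → H) (s : Set ι) : Submodule ℂ H where
  carrier := {y | ∃ c : lp (fun _ : ι => ℂ) 2, HasSum (fun i : s => c i • f i) y}
  add_mem' := by
    rintro _ _ ⟨c, hc⟩ ⟨d, hd⟩
    exact ⟨c + d, by simpa [add_smul] using hc.add hd⟩
  zero_mem' := ⟨0, by simp⟩
  smul_mem' := by
    rintro a _ ⟨c, hc⟩
    exact ⟨a • c, by simpa [mul_smul] using hc.const_smul a⟩

/-- A `J`-frame: a Bessel family such that `R(T₊)` is a maximal uniformly positive subspace and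
`R(T₋)` is a maximal uniformly negative subspace. -/
structure IsJFrame (J : H →L[ℂ] H) (f : ι → H) : Prop where
  isBessel : IsBessel f
  maximal_pos : Maximal (IsUniformlyPositive J) (synthesisRange f (posIndex J f))
  maximal_neg : Maximal (IsUniformlyNegative J) (synthesisRange f (negIndex J f))

open Classical in
/-- The sign of `i`: `1` on `I₊` and `-1` on `I₋`. -/
def indexSign (J : H →L[ℂ] H) (f : ι → H) (i : ι) : ℂ := if i ∈ posIndex J f then 1 else -1

/-- `S` is the `J`-frame operator of the `J`-frame `f`:
`S x = ∑_{i ∈ I₊} [x, fᵢ] fᵢ - ∑_{i ∈ I₋} [x, fᵢ] fᵢ` for all `x`. -/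
structure IsJFrameOperator (J : H →L[ℂ] H) (f : ι → H) (S : H →L[ℂ] H) : Prop where
  isJFrame : IsJFrame J f
  hasSum : ∀ x : H, HasSum (fun i => (indexSign J f i * kreinForm J x (f i)) • f i) (S x)

end Frames

section Operators

variable {E : Type*} [NormedAddCommGroup E] [InnerProductSpace ℂ E] [CompleteSpace E]

/-- A uniformly positive operator on a Hilbert space: positive and boundedly invertible. -/
def UniformlyPositiveOp (T : E →L[ℂ] E) : Prop := T.IsPositive ∧ IsUnit T

/-- The numerical range `W(T) = {⟨T x, x⟩ : ‖x‖ = 1}`. -/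
def numericalRange (T : E →L[ℂ] E) : Set ℂ := {z | ∃ x : E, ‖x‖ = 1 ∧ inner ℂ x (T x) = z}

/-- The closure of the numerical range of `T` is the (non-empty) real interval `[a, b]`. -/
def HasClosedNumericalRange (T : E →L[ℂ] E) (a b : ℝ) : Prop :=
  a ≤ b ∧ closure (numericalRange T) = Complex.ofReal '' Set.Icc a b

end Operators

section Blocks

variable {H : Type*} [NormedAddCommGroup H] [InnerProductSpace ℂ H] [CompleteSpace H]
variable {P : Type*} [NormedAddCommGroup P] [InnerProductSpace ℂ P] [CompleteSpace P]
variable {N : Type*} [NormedAddCommGroup N] [InnerProductSpace ℂ N] [CompleteSpace N]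

/-- A fundamental decomposition of the Krein space `(H, J)`: the space is identified, as a vector
space, with the direct sum of two Hilbert spaces `P` and `N` in such a way that
`[x, y] = ⟨x₊, y₊⟩ - ⟨x₋, y₋⟩`; that is, the summands are orthogonal for `[·, ·]`, the inner
product of `P` is `[·, ·]`, and that of `N` is `-[·, ·]`. It need not be the decomposition given
by `J` itself. -/
structure FundamentalDecomposition (J : H →L[ℂ] H) (P : Type*) [NormedAddCommGroup P]
    [InnerProductSpace ℂ P] [CompleteSpace P] (N : Type*) [NormedAddCommGroup N]
    [InnerProductSpace ℂ N] [CompleteSpace N] where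
  equiv : H ≃ₗ[ℂ] P × N
  form_eq : ∀ x y : H, kreinForm J x y =
    inner ℂ (equiv y).1 (equiv x).1 - inner ℂ (equiv y).2 (equiv x).2

/-- With respect to the decomposition `F`, the operator `S` is the block operator matrix
`[A, -A K; K* A, D]` with `A` uniformly positive, `‖K‖ < 1`, `D` self-adjoint and
`D + K* A K` uniformly positive. -/
structure IsFirstBlockForm {J : H →L[ℂ] H} (F : FundamentalDecomposition J P N) (S : H →L[ℂ] H)
    (A : P →L[ℂ] P) (K : N →L[ℂ] P) (D : N →L[ℂ] N) : Prop where
  pos : UniformlyPositiveOp A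
  norm_lt_one : ‖K‖ < 1
  isSelfAdjoint : IsSelfAdjoint D
  schur_pos : UniformlyPositiveOp (D + K† ∘L A ∘L K)
  fst_eq : ∀ x : H, (F.equiv (S x)).1 = A (F.equiv x).1 - A (K (F.equiv x).2)
  snd_eq : ∀ x : H, (F.equiv (S x)).2 = (K†) (A (F.equiv x).1) + D (F.equiv x).2

/-- With respect to the decomposition `F`, the operator `S` is the block operator matrix
`[A, L D; -D L*, D]` with `A` self-adjoint, `‖L‖ < 1`, `D` uniformly positive and
`A + L D L*` uniformly positive. -/
structure IsSecondBlockForm {J : H →L[ℂ] H} (F : FundamentalDecomposition J P N) (S : H →L[ℂ] H)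
    (A : P →L[ℂ] P) (L : N →L[ℂ] P) (D : N →L[ℂ] N) : Prop where
  pos : UniformlyPositiveOp D
  norm_lt_one : ‖L‖ < 1
  isSelfAdjoint : IsSelfAdjoint A
  schur_pos : UniformlyPositiveOp (A + L ∘L D ∘L L†)
  fst_eq : ∀ x : H, (F.equiv (S x)).1 = A (F.equiv x).1 + L (D (F.equiv x).2)
  snd_eq : ∀ x : H, (F.equiv (S x)).2 = -D ((L†) (F.equiv x).1) + D (F.equiv x).2

end Blocks

end KreinFrame

end

/-! Spectral enclosures for `J`-frame operators.

An operator that is symmetric for `[·, ·]` satisfies `(T - z)† J = J (T - z̄)`; hence `z` is in the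
resolvent set as soon as `T - z` and `T - z̄` are both bounded below
(`notMem_spectrum_of_bounded_below`), and everything reduces to such lower bounds at points outside
the (conjugation symmetric) enclosing region.

*Block operators.* Put `z = x - K y` and `B = D + K† A K`. The eigenvalue equation for
`[A, -A K; K† A, D]` at `l` becomes `(A - l) z = l K y` and `(B - l (1 - K† K)) y = -l K† z`.
Testing against `z` and `y` gives two scalar equations in `α = ⟨A z, z⟩`, `β = ⟨B y, y⟩`,
`p = ‖z‖²`, `q = ‖y‖² - ‖K y‖²` and `s = ⟨K y, z⟩`. For non-real `l` they force
`α = β = |l|² σ` and `p + q = 2 σ Re l` for some `σ > 0`; then `α ≤ a₂ p` gives `|l|² < 2 a₂ Re l`,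
which is the disc, and the Cauchy-Schwarz inequality `|s|² ≤ p ‖K y‖²` gives `b₁ σ ≤ p < 2 σ Re l`
(`IsGramData.of_im_ne_zero`). For real `l` one gets `α + β = l (p + q)`, which is the lower bound
(`IsGramData.min_le_re`). The admissible normalised tuples form a compact set, so having no solution
at `l` yields a quantitative lower bound (`exists_block_lower_bound`). The upper bound on the real
spectrum comes from the numerical range of the block operator
(`exists_block_lower_bound_of_lt`). The second block form is the first one with the summands
exchanged.

*The right half-plane.* No block form is needed: write `S x = g - h` with `g` in the maximal
uniformly positive and `h` in the maximal uniformly negative range. If `S x = l x`, then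
`Re l · ∑ |[x, fᵢ]|² = [g, g] - [h, h]`, which is at least `ε (‖g‖² + ‖h‖²)`. The perturbed form of
this identity shows that `g` and `h` are controlled by `S x - l x` when `Re l ≤ 0`, and `x` is
controlled by `g` and `h` because a `J`-frame has a lower frame bound
(`IsJFrame.exists_lower_bound`). That bound follows by uniform boundedness from the fact that the
two ranges span the space, which is where maximality enters (`exists_sub_eq_of_maximal`). -/

noncomputable section

namespace KreinFrame

/-! ### Symmetric operators on a Krein space and numerical ranges -/

section Basic
variable {E : Type*} [NormedAddCommGroup E] [InnerProductSpace ℂ E]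

theorem inner_self_eq_ofReal (x : E) : (inner ℂ x x : ℂ) = ((‖x‖ ^ 2 : ℝ) : ℂ) := by
  rw [inner_self_eq_norm_sq_to_K]; norm_cast

theorem IsFundamentalSymmetry.apply_apply [CompleteSpace E] {J : E →L[ℂ] E}
    (hJ : IsFundamentalSymmetry J) (x : E) :
    J (J x) = x := by
  simpa using congrArg (fun T : E →L[ℂ] E => T x) hJ.sq_eq_one

theorem IsFundamentalSymmetry.inner_left [CompleteSpace E] {J : E →L[ℂ] E}
    (hJ : IsFundamentalSymmetry J)
    (x y : E) : inner ℂ (J x) y = inner ℂ x (J y) :=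
  hJ.isSelfAdjoint.isSymmetric x y

theorem IsFundamentalSymmetry.norm_apply [CompleteSpace E] {J : E →L[ℂ] E}
    (hJ : IsFundamentalSymmetry J) (x : E) :
    ‖J x‖ = ‖x‖ := by
  have h : (inner ℂ (J x) (J x) : ℂ) = inner ℂ x x := by
    rw [hJ.inner_left, hJ.apply_apply]
  rw [inner_self_eq_ofReal, inner_self_eq_ofReal] at h
  have h' : ‖J x‖ ^ 2 = ‖x‖ ^ 2 := by exact_mod_cast h
  exact (sq_eq_sq₀ (norm_nonneg _) (norm_nonneg _)).1 h'

theorem IsFundamentalSymmetry.neg [CompleteSpace E] {J : E →L[ℂ] E} (hJ : IsFundamentalSymmetry J) :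
    IsFundamentalSymmetry (-J) :=
  ⟨hJ.isSelfAdjoint.neg, by rw [neg_mul_neg, hJ.sq_eq_one]⟩

theorem kreinForm_conj_symm [CompleteSpace E] {J : E →L[ℂ] E} (hJ : IsFundamentalSymmetry J)
    (x y : E) :
    starRingEnd ℂ (kreinForm J x y) = kreinForm J y x := by
  simp only [kreinForm]
  rw [inner_conj_symm, hJ.inner_left]

theorem norm_kreinForm_le [CompleteSpace E] {J : E →L[ℂ] E} (hJ : IsFundamentalSymmetry J)
    (x y : E) :
    ‖kreinForm J x y‖ ≤ ‖x‖ * ‖y‖ := by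
  have := norm_inner_le_norm (𝕜 := ℂ) y (J x)
  rw [hJ.norm_apply, mul_comm] at this
  exact this

theorem isUniformlyNegative_eq (J : E →L[ℂ] E) :
    IsUniformlyNegative J = IsUniformlyPositive (-J) := by
  funext L
  simp [IsUniformlyNegative, IsUniformlyPositive, kreinForm]

/-- A `J`-symmetric operator satisfies `(T - z)† J = J (T - z̄)`, so a lower bound for `T - z̄`
makes the range of `T - z` dense, and a lower bound for `T - z` makes it closed. -/
theorem notMem_spectrum_of_bounded_below [CompleteSpace E] {J : E →L[ℂ] E}
    (hJ : IsFundamentalSymmetry J)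
    {T : E →L[ℂ] E} (hT : ∀ x y, kreinForm J (T x) y = kreinForm J x (T y)) {z : ℂ}
    (h₁ : ∃ C : ℝ, ∀ x, ‖x‖ ≤ C * ‖T x - z • x‖)
    (h₂ : ∃ C : ℝ, ∀ x, ‖x‖ ≤ C * ‖T x - starRingEnd ℂ z • x‖) :
    z ∉ spectrum ℂ T := by
  rw [spectrum.notMem_iff]
  set R : E →L[ℂ] E := algebraMap ℂ (E →L[ℂ] E) z - T with hR
  have hRx : ∀ x, R x = z • x - T x := fun x => by
    simp [hR, Algebra.algebraMap_eq_smul_one]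
  obtain ⟨C, hC⟩ := h₁
  obtain ⟨C', hC'⟩ := h₂
  have hanti : AntilipschitzWith (Real.toNNReal C) R := by
    refine R.antilipschitz_of_bound fun x => ?_
    rw [hRx, norm_sub_rev]
    exact (hC x).trans (mul_le_mul_of_nonneg_right (Real.le_coe_toNNReal C) (norm_nonneg _))
  have hclosed : IsClosed (Set.range R) := hanti.isClosed_range R.uniformContinuous
  have horth : R.rangeᗮ = ⊥ := by
    rw [Submodule.eq_bot_iff]
    intro w hw
    have hw' : ∀ u, inner ℂ (R u) w = (0 : ℂ) := fun u =>
      (Submodule.mem_orthogonal _ _).1 hw _ ⟨u, rfl⟩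
    have hv : starRingEnd ℂ z • J w - T (J w) = 0 := by
      have key : J (starRingEnd ℂ z • J w - T (J w)) = 0 := by
        refine ext_inner_left ℂ fun u => ?_
        have h1 := hw' u
        have h2 := hT (J w) u
        simp only [kreinForm, hJ.apply_apply] at h2
        rw [hRx, inner_sub_left, inner_smul_left, ← h2] at h1
        simpa [inner_sub_right, inner_smul_right, hJ.apply_apply] using h1
      rw [← hJ.apply_apply (starRingEnd ℂ z • J w - T (J w)), key, map_zero]
    have h3 := hC' (J w)
    rw [norm_sub_rev, hv, norm_zero, mul_zero, hJ.norm_apply] at h3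
    exact norm_le_zero_iff.1 h3
  rw [ContinuousLinearMap.isUnit_iff_bijective]
  refine ⟨hanti.injective, ?_⟩
  have htop := Submodule.topologicalClosure_eq_top_iff.2 horth
  have hcl : IsClosed (R.range : Set E) := by simpa [LinearMap.coe_range] using hclosed
  rw [hcl.submodule_topologicalClosure_eq] at htop
  exact LinearMap.range_eq_top.1 htop

/-- A uniformly positive operator is coercive. -/
theorem UniformlyPositiveOp.exists_coercive [CompleteSpace E] {T : E →L[ℂ] E}
    (hT : UniformlyPositiveOp T) :
    ∃ c : ℝ, 0 < c ∧ ∀ x, c * ‖x‖ ^ 2 ≤ (inner ℂ x (T x) : ℂ).re := by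
  obtain ⟨hpos, u, hu⟩ := hT
  set V : E →L[ℂ] E := ((u⁻¹ : (E →L[ℂ] E)ˣ) : E →L[ℂ] E) with hV
  have hVT : ∀ x, V (T x) = x := fun x => by
    have h : V * T = 1 := by rw [hV, ← hu]; simp
    simpa using congrArg (fun T : E →L[ℂ] E => T x) h
  set t : ℝ := (‖T‖ + 1)⁻¹ with ht
  have hnT := norm_nonneg T
  have ht0 : 0 < t := by positivity
  have ht1 : t * ‖T‖ ≤ 1 := by
    rw [ht, inv_mul_le_iff₀ (by positivity)]; linarith
  have hsym : ∀ x y, (inner ℂ (T x) y : ℂ) = inner ℂ x (T y) := hpos.isSymmetric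
  -- Positivity of the form at `x - t T x` bounds `‖T x‖²` by the form at `x`.
  have h1 : ∀ x, t * ‖T x‖ ^ 2 ≤ (inner ℂ x (T x) : ℂ).re := fun x => by
    have h0 : 0 ≤ (inner ℂ (x - (t : ℂ) • T x) (T (x - (t : ℂ) • T x)) : ℂ).re :=
      hpos.re_inner_nonneg_right _
    have hTT : (inner ℂ (T x) (T (T x)) : ℂ).re ≤ ‖T‖ * ‖T x‖ ^ 2 := by
      refine (Complex.re_le_norm _).trans ((norm_inner_le_norm _ _).trans ?_)
      nlinarith [T.le_opNorm (T x), norm_nonneg (T x)]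
    have hself : (inner ℂ (T x) (T x) : ℂ).re = ‖T x‖ ^ 2 := by
      rw [inner_self_eq_ofReal, Complex.ofReal_re]
    simp only [map_sub, map_smul, inner_sub_left, inner_sub_right, inner_smul_left,
      inner_smul_right, Complex.conj_ofReal, ← hsym x (T x), Complex.sub_re,
      Complex.re_ofReal_mul] at h0
    rw [hself] at h0
    have := mul_le_mul_of_nonneg_left hTT (mul_nonneg ht0.le ht0.le)
    have h4 := mul_le_mul_of_nonneg_right ht1 (mul_nonneg ht0.le (sq_nonneg ‖T x‖))
    nlinarith
  have h2 : ∀ x, ‖x‖ ≤ (‖V‖ + 1) * ‖T x‖ := fun x => by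
    have := V.le_opNorm (T x)
    rw [hVT] at this
    nlinarith [norm_nonneg (T x)]
  refine ⟨t / (‖V‖ + 1) ^ 2, by positivity, fun x => le_trans ?_ (h1 x)⟩
  rw [div_mul_eq_mul_div, div_le_iff₀ (by positivity), mul_assoc]
  refine mul_le_mul_of_nonneg_left ?_ ht0.le
  calc ‖x‖ ^ 2 ≤ ((‖V‖ + 1) * ‖T x‖) ^ 2 := pow_le_pow_left₀ (norm_nonneg _) (h2 x) 2
    _ = _ := by ring

theorem HasClosedNumericalRange.bounds {T : E →L[ℂ] E} {a b : ℝ}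
    (h : HasClosedNumericalRange T a b) (x : E) :
    a * ‖x‖ ^ 2 ≤ (inner ℂ x (T x) : ℂ).re ∧ (inner ℂ x (T x) : ℂ).re ≤ b * ‖x‖ ^ 2 := by
  rcases eq_or_ne x 0 with rfl | hx
  · simp
  have hn : 0 < ‖x‖ := norm_pos_iff.2 hx
  set y : E := ((‖x‖⁻¹ : ℝ) : ℂ) • x with hy
  have hy1 : ‖y‖ = 1 := by
    rw [hy, norm_smul, Complex.norm_real, Real.norm_of_nonneg (by positivity)]
    exact inv_mul_cancel₀ hn.ne'
  have hmem : (inner ℂ y (T y) : ℂ) ∈ closure (numericalRange T) :=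
    subset_closure ⟨y, hy1, rfl⟩
  rw [h.2] at hmem
  obtain ⟨t, ht, hty⟩ := hmem
  have hre : t = (‖x‖ ^ 2)⁻¹ * (inner ℂ x (T x) : ℂ).re := by
    have := congrArg Complex.re hty
    simp only [hy, map_smul, inner_smul_left, inner_smul_right, Complex.conj_ofReal,
      Complex.re_ofReal_mul, Complex.ofReal_re] at this
    rw [this]; field_simp
  have hre' : (inner ℂ x (T x) : ℂ).re = t * ‖x‖ ^ 2 := by rw [hre]; field_simp
  rw [hre']
  exact ⟨mul_le_mul_of_nonneg_right ht.1 (by positivity),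
    mul_le_mul_of_nonneg_right ht.2 (by positivity)⟩

theorem HasClosedNumericalRange.pos [CompleteSpace E] {T : E →L[ℂ] E} {a b : ℝ}
    (h : HasClosedNumericalRange T a b) (hT : UniformlyPositiveOp T) : 0 < a := by
  obtain ⟨c, hc, hcT⟩ := hT.exists_coercive
  have hsub : closure (numericalRange T) ⊆ {z : ℂ | c ≤ z.re} := by
    refine closure_minimal ?_ (isClosed_le continuous_const Complex.continuous_re)
    rintro _ ⟨x, hx, rfl⟩
    simpa [hx] using hcT x
  have : (a : ℂ) ∈ closure (numericalRange T) := by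
    rw [h.2]; exact ⟨a, ⟨le_rfl, h.1⟩, rfl⟩
  exact hc.trans_le (by simpa using hsub this)

end Basic

/-! ### The scalar eigenvalue equations of the block operator -/

section BlockOperator

/-- Numbers that behave like `α = ⟨A z, z⟩`, `β = ⟨B y, y⟩`, `p = ‖z‖²`, `r = ‖y‖²`, `k = ‖K y‖²`
and `s = ⟨K y, z⟩`, normalised by `‖z‖² + ‖y‖² = 1`, when `W(A)` and `W(B)` lie in `[a₁, a₂]` and
`[b₁, b₂]` and `‖K‖ ≤ κ`. -/
structure IsGramData (a₁ a₂ b₁ b₂ κ α β p r k : ℝ) (s : ℂ) : Prop where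
  p_nonneg : 0 ≤ p
  r_nonneg : 0 ≤ r
  add_eq_one : p + r = 1
  le_α : a₁ * p ≤ α
  α_le : α ≤ a₂ * p
  le_β : b₁ * r ≤ β
  β_le : β ≤ b₂ * r
  k_nonneg : 0 ≤ k
  k_le : k ≤ κ ^ 2 * r
  norm_sq_le : ‖s‖ ^ 2 ≤ p * k

/-- The size of the defect in the eigenvalue equations `(A - l) z = l K y` and
`(B - l (1 - K† K)) y = -l K† z`, tested against `z` and `y`. -/
def gramDefect (l : ℂ) (α β p r k : ℝ) (s : ℂ) : ℝ :=
  ‖(α : ℂ) - l * p - l * s‖ + ‖(β : ℂ) - l * (r - k : ℝ) + l * starRingEnd ℂ s‖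

variable {a₁ a₂ b₁ b₂ κ α β p r k : ℝ} {s l : ℂ}

theorem gramDefect_eq_zero (h : gramDefect l α β p r k s = 0) :
    (α - l.re * p = l.re * s.re - l.im * s.im ∧ -(l.im * p) = l.re * s.im + l.im * s.re) ∧
    (β - l.re * (r - k) = -(l.re * s.re + l.im * s.im) ∧
      -(l.im * (r - k)) = -(l.im * s.re - l.re * s.im)) := by
  unfold gramDefect at h
  have h1 := (add_eq_zero_iff_of_nonneg (norm_nonneg _) (norm_nonneg _)).1 h
  have h2 := norm_eq_zero.1 h1.1
  have h3 := norm_eq_zero.1 h1.2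
  rw [Complex.ext_iff] at h2 h3
  simp at h2 h3
  refine ⟨⟨?_, ?_⟩, ?_, ?_⟩ <;> linarith [h2.1, h2.2, h3.1, h3.2]

/-- With `σ = -Im s / Im l`, the equations give `α = β = |l|² σ`, `p + (r - k) = 2 σ Re l` and
`|s|² = α σ - p (r - k)`. -/
theorem IsGramData.of_im_ne_zero (hG : IsGramData a₁ a₂ b₁ b₂ κ α β p r k s) (ha : 0 < a₁)
    (hb : 0 < b₁) (hκ0 : 0 ≤ κ) (hκ : κ < 1) (hl : l.im ≠ 0)
    (h : gramDefect l α β p r k s = 0) : ‖l - a₂‖ < a₂ ∧ b₁ / 2 < l.re := by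
  obtain ⟨⟨h1, h2⟩, h3, h4⟩ := gramDefect_eq_zero h
  obtain ⟨hp, hr, hpr, hα, hα', hβ, hβ', hk, hk', hs⟩ := hG
  rw [← Complex.normSq_eq_norm_sq, Complex.normSq_apply] at hs
  set x := l.re
  set m := l.im
  set q := r - k with hq
  obtain ⟨σ, hσ⟩ : ∃ σ, s.im = -(m * σ) := ⟨-(s.im / m), by field_simp⟩
  rw [hσ] at h1 h2 h3 h4 hs
  have e1 : s.re = x * σ - p := mul_left_cancel₀ hl (by linarith)
  have e2 : q = s.re + x * σ := mul_left_cancel₀ hl (by linarith)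
  have hαe : α = (x ^ 2 + m ^ 2) * σ := by rw [e1] at h1; linarith
  have hβe : β = (x ^ 2 + m ^ 2) * σ := by rw [e2] at h3; linarith
  have hpq : p + q = 2 * (x * σ) := by linarith
  have hn : 0 < x ^ 2 + m ^ 2 := by positivity
  have hκ2 : 0 < 1 - κ ^ 2 := by nlinarith
  have hq' : (1 - κ ^ 2) * r ≤ q := by rw [hq]; linarith
  have hα0 : 0 < α := by
    have hα1 : 0 ≤ α := le_trans (by positivity) hα
    refine lt_of_le_of_ne hα1 fun h0 => ?_
    have hp0 : p = 0 := by
      by_contra hne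
      have := mul_pos ha (lt_of_le_of_ne hp (Ne.symm hne))
      linarith
    have hr0 : r = 0 := by
      by_contra hne
      have := mul_pos hb (lt_of_le_of_ne hr (Ne.symm hne))
      linarith
    linarith
  have hσ0 : 0 < σ := by
    rw [hαe] at hα0
    exact (mul_pos_iff_of_pos_left hn).1 hα0
  have hr0 : 0 < r := by
    refine lt_of_le_of_ne hr fun h0 => ?_
    rw [← h0, mul_zero] at hβ'
    linarith
  have hp0 : 0 < p := by
    refine lt_of_le_of_ne hp fun h0 => ?_
    rw [← h0, mul_zero] at hα'
    linarith
  have hq0 : 0 < q := lt_of_lt_of_le (mul_pos hκ2 hr0) hq'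
  have ha2 : 0 < a₂ := by
    by_contra hneg
    nlinarith
  constructor
  · have h5 : x ^ 2 + m ^ 2 < 2 * x * a₂ := by
      refine lt_of_mul_lt_mul_right ?_ hσ0.le
      calc (x ^ 2 + m ^ 2) * σ = α := hαe.symm
        _ ≤ a₂ * p := hα'
        _ < a₂ * (p + q) := mul_lt_mul_of_pos_left (by linarith) ha2
        _ = 2 * x * a₂ * σ := by rw [hpq]; ring
    refine lt_of_pow_lt_pow_left₀ 2 ha2.le ?_
    rw [← Complex.normSq_eq_norm_sq, Complex.normSq_apply]
    simp only [Complex.sub_re, Complex.sub_im, Complex.ofReal_re, Complex.ofReal_im, sub_zero]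
    change (x - a₂) * (x - a₂) + m * m < a₂ ^ 2
    nlinarith
  · have h6 : α * σ ≤ p * r := by
      have h7 : s.re * s.re + -(m * σ) * -(m * σ) = α * σ - p * q := by
        have hq2 : q = 2 * (x * σ) - p := by linarith
        rw [e1, hq2, hαe]; ring
      have h8 : p * r = p * q + p * k := by rw [hq]; ring
      linarith
    have h9 : b₁ * σ ≤ p := by
      refine le_of_mul_le_mul_right ?_ hr0
      have : b₁ * r * σ ≤ α * σ :=
        mul_le_mul_of_nonneg_right (by rw [hαe, ← hβe]; exact hβ) hσ0.le
      linarith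
    have h10 : b₁ * σ < 2 * x * σ := by linarith
    have := lt_of_mul_lt_mul_right h10 hσ0.le
    linarith

theorem IsGramData.min_le_re (hG : IsGramData a₁ a₂ b₁ b₂ κ α β p r k s)
    (hb : 0 < b₁) (hκ0 : 0 ≤ κ) (hκ : κ < 1) (hl : l.im = 0)
    (h : gramDefect l α β p r k s = 0) : min a₁ b₁ ≤ l.re := by
  obtain ⟨⟨h1, -⟩, h3, -⟩ := gramDefect_eq_zero h
  obtain ⟨hp, hr, hpr, hα, -, hβ, -, hk, hk', -⟩ := hG
  rw [hl] at h1 h3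
  have hκ2 : 0 < 1 - κ ^ 2 := by nlinarith
  have hq' : (1 - κ ^ 2) * r ≤ r - k := by linarith
  have hq0 : 0 ≤ r - k := le_trans (mul_nonneg hκ2.le hr) hq'
  have hpq : 0 < p + (r - k) := by
    refine lt_of_le_of_ne (by positivity) fun h0 => ?_
    have hr0 : r = 0 := by
      by_contra hne
      have := mul_pos hκ2 (lt_of_le_of_ne hr (Ne.symm hne))
      linarith
    have : r - k ≤ 0 := by linarith
    linarith
  refine le_of_mul_le_mul_right ?_ hpq
  have h4 := mul_le_mul_of_nonneg_right (min_le_left a₁ b₁) hp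
  have h5 := mul_le_mul_of_nonneg_right (min_le_right a₁ b₁) hq0
  have h6 := mul_nonneg hb.le hk
  linarith

theorem isCompact_gramData (a₁ a₂ b₁ b₂ κ : ℝ) : IsCompact
    {v : ℝ × ℝ × ℝ × ℝ × ℝ × ℂ |
      IsGramData a₁ a₂ b₁ b₂ κ v.1 v.2.1 v.2.2.1 v.2.2.2.1 v.2.2.2.2.1 v.2.2.2.2.2} := by
  have hset : {v : ℝ × ℝ × ℝ × ℝ × ℝ × ℂ |
      IsGramData a₁ a₂ b₁ b₂ κ v.1 v.2.1 v.2.2.1 v.2.2.2.1 v.2.2.2.2.1 v.2.2.2.2.2} =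
      {v | 0 ≤ v.2.2.1 ∧ 0 ≤ v.2.2.2.1 ∧ v.2.2.1 + v.2.2.2.1 = 1 ∧ a₁ * v.2.2.1 ≤ v.1 ∧
        v.1 ≤ a₂ * v.2.2.1 ∧ b₁ * v.2.2.2.1 ≤ v.2.1 ∧ v.2.1 ≤ b₂ * v.2.2.2.1 ∧
        0 ≤ v.2.2.2.2.1 ∧ v.2.2.2.2.1 ≤ κ ^ 2 * v.2.2.2.1 ∧
        ‖v.2.2.2.2.2‖ ^ 2 ≤ v.2.2.1 * v.2.2.2.2.1} := by
    ext v
    exact ⟨fun ⟨h1, h2, h3, h4, h5, h6, h7, h8, h9, h10⟩ =>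
      ⟨h1, h2, h3, h4, h5, h6, h7, h8, h9, h10⟩,
      fun ⟨h1, h2, h3, h4, h5, h6, h7, h8, h9, h10⟩ =>
      ⟨h1, h2, h3, h4, h5, h6, h7, h8, h9, h10⟩⟩
  refine IsCompact.of_isClosed_subset (s := Set.Icc (-|a₁|) |a₂| ×ˢ Set.Icc (-|b₁|) |b₂| ×ˢ
    Set.Icc 0 1 ×ˢ Set.Icc 0 1 ×ˢ Set.Icc 0 (κ ^ 2) ×ˢ Metric.closedBall (0 : ℂ) (1 + κ ^ 2))
    (isCompact_Icc.prod (isCompact_Icc.prod (isCompact_Icc.prod (isCompact_Icc.prod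
      (isCompact_Icc.prod (isCompact_closedBall _ _)))))) ?_ ?_
  · rw [hset]
    simp only [Set.ofPred_and]
    repeat' refine IsClosed.inter ?_ ?_
    all_goals first
      | exact isClosed_le (by fun_prop) (by fun_prop)
      | exact isClosed_eq (by fun_prop) (by fun_prop)
  · rintro ⟨α, β, p, r, k, s⟩ ⟨hp, hr, hpr, hα, hα', hβ, hβ', hk, hk', hs⟩
    dsimp only at *
    have hp1 : p ≤ 1 := by linarith
    have hr1 : r ≤ 1 := by linarith
    have hk1 : k ≤ κ ^ 2 := hk'.trans (mul_le_of_le_one_right (sq_nonneg _) hr1)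
    refine ⟨⟨?_, ?_⟩, ⟨?_, ?_⟩, ⟨hp, hp1⟩, ⟨hr, hr1⟩, ⟨hk, hk1⟩, ?_⟩
    · nlinarith [neg_abs_le a₁, abs_nonneg a₁]
    · nlinarith [le_abs_self a₂, abs_nonneg a₂]
    · nlinarith [neg_abs_le b₁, abs_nonneg b₁]
    · nlinarith [le_abs_self b₂, abs_nonneg b₂]
    · rw [mem_closedBall_zero_iff]
      have : p * k ≤ κ ^ 2 := (mul_le_of_le_one_left hk hp1).trans hk1
      nlinarith [sq_nonneg (‖s‖ - 1), norm_nonneg s]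

theorem exists_gramDefect_lower_bound (a₁ a₂ b₁ b₂ κ : ℝ) (l : ℂ)
    (h : ∀ α β p r k s, IsGramData a₁ a₂ b₁ b₂ κ α β p r k s → gramDefect l α β p r k s ≠ 0) :
    ∃ c : ℝ, 0 < c ∧ ∀ α β p r k s, IsGramData a₁ a₂ b₁ b₂ κ α β p r k s →
      c ≤ gramDefect l α β p r k s := by
  have hcont : Continuous fun v : ℝ × ℝ × ℝ × ℝ × ℝ × ℂ =>
      gramDefect l v.1 v.2.1 v.2.2.1 v.2.2.2.1 v.2.2.2.2.1 v.2.2.2.2.2 := by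
    unfold gramDefect
    have := Complex.continuous_conj
    fun_prop
  have hpos : ∀ v ∈ {v : ℝ × ℝ × ℝ × ℝ × ℝ × ℂ |
      IsGramData a₁ a₂ b₁ b₂ κ v.1 v.2.1 v.2.2.1 v.2.2.2.1 v.2.2.2.2.1 v.2.2.2.2.2},
      0 < gramDefect l v.1 v.2.1 v.2.2.1 v.2.2.2.1 v.2.2.2.2.1 v.2.2.2.2.2 := fun v hv =>
    lt_of_le_of_ne (by unfold gramDefect; positivity) (h _ _ _ _ _ _ hv).symm
  obtain ⟨c, hc, hc'⟩ :=
    (isCompact_gramData a₁ a₂ b₁ b₂ κ).exists_forall_le' hcont.continuousOn hpos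
  exact ⟨c, hc, fun α β p r k s hG => hc' (α, β, p, r, k, s) hG⟩

end BlockOperator

/-! ### The spectrum of a `J`-frame operator lies in the right half-plane -/

section FrameOperator
variable {H : Type*} [NormedAddCommGroup H] [InnerProductSpace ℂ H]
variable {ι : Type*} {J : H →L[ℂ] H} {f : ι → H} {S : H →L[ℂ] H}

theorem isClosed_of_maximal {M : Submodule ℂ H} (hM : Maximal (IsUniformlyPositive J) M) :
    IsClosed (M : Set H) := by
  obtain ⟨α, hα, hαM⟩ := hM.prop
  have hclos : IsClosed {x : H | α * ‖x‖ ^ 2 ≤ (kreinForm J x x).re} := by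
    refine isClosed_le (by fun_prop) (Complex.continuous_re.comp ?_)
    exact Continuous.inner continuous_id J.continuous
  have h : IsUniformlyPositive J M.topologicalClosure :=
    ⟨α, hα, fun x hx => closure_minimal (s := (M : Set H)) hαM hclos hx⟩
  have := hM.le_of_ge h M.le_topologicalClosure
  exact isClosed_of_closure_subset this

/-- If `x` is `J`-orthogonal to `M` and `[x, x] ≥ 0`, then `M ⊔ span {x + ε J x}` is still uniformly
positive for small `ε > 0`, since `[x + ε J x, x + ε J x] ≥ 2 ε ‖x‖²`. -/
theorem eq_zero_of_orthogonal_of_maximal [CompleteSpace H] (hJ : IsFundamentalSymmetry J)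
    {M : Submodule ℂ H}
    (hM : Maximal (IsUniformlyPositive J) M) {x : H} (hx : ∀ m ∈ M, kreinForm J m x = 0)
    (hxx : 0 ≤ (kreinForm J x x).re) : x = 0 := by
  obtain ⟨ε, hε, hεM⟩ := hM.prop
  set w : H := x + (ε : ℂ) • J x with hw
  have hself : (inner ℂ x x : ℂ).re = ‖x‖ ^ 2 := by
    rw [inner_self_eq_ofReal, Complex.ofReal_re]
  have hww : 2 * ε * ‖x‖ ^ 2 ≤ (kreinForm J w w).re := by
    simp only [hw, kreinForm, map_add, map_smul, hJ.apply_apply, inner_add_left, inner_add_right,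
      inner_smul_left, inner_smul_right, Complex.conj_ofReal, Complex.add_re,
      Complex.re_ofReal_mul]
    rw [hJ.inner_left x (J x), hJ.apply_apply, hJ.inner_left x x, hself]
    have : (0 : ℝ) ≤ (inner ℂ x (J x) : ℂ).re := hxx
    nlinarith [mul_nonneg (mul_nonneg hε.le hε.le) this]
  have hmw : ∀ m ∈ M, ‖kreinForm J m w‖ ≤ ε * (‖m‖ * ‖x‖) := fun m hm => by
    have h1 : kreinForm J m w = (ε : ℂ) * inner ℂ x m := by
      have := hx m hm
      simp only [kreinForm] at this
      simp only [hw, kreinForm, inner_add_left, inner_smul_left, Complex.conj_ofReal, this,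
        hJ.inner_left x (J m), hJ.apply_apply, zero_add]
    rw [h1, norm_mul, Complex.norm_real, Real.norm_of_nonneg hε.le, mul_comm ‖m‖]
    exact mul_le_mul_of_nonneg_left (norm_inner_le_norm _ _) hε.le
  have hwn : ‖w‖ ≤ (1 + ε) * ‖x‖ := by
    calc ‖w‖ ≤ ‖x‖ + ‖(ε : ℂ) • J x‖ := norm_add_le _ _
      _ = (1 + ε) * ‖x‖ := by
        rw [norm_smul, Complex.norm_real, Real.norm_of_nonneg hε.le, hJ.norm_apply]; ring
  have hpos : IsUniformlyPositive J (M ⊔ Submodule.span ℂ {w}) := by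
    refine ⟨ε / (1 + (2 + ε) ^ 2), by positivity, fun v hv => ?_⟩
    obtain ⟨m, hm, y, hy, rfl⟩ := Submodule.mem_sup.1 hv
    obtain ⟨c, rfl⟩ := Submodule.mem_span_singleton.1 hy
    have hexp : (kreinForm J (m + c • w) (m + c • w)).re =
        (kreinForm J m m).re + 2 * (starRingEnd ℂ c * kreinForm J m w).re +
          ‖c‖ ^ 2 * (kreinForm J w w).re := by
      have h1 : kreinForm J (m + c • w) (m + c • w) = kreinForm J m m +
          (starRingEnd ℂ c * kreinForm J m w + starRingEnd ℂ (starRingEnd ℂ c * kreinForm J m w)) +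
          (starRingEnd ℂ c * c) * kreinForm J w w := by
        rw [map_mul, kreinForm_conj_symm hJ]
        simp only [kreinForm, map_add, map_smul, inner_add_left, inner_add_right,
          inner_smul_left, inner_smul_right, Complex.conj_conj]
        ring
      rw [h1, Complex.conj_mul', Complex.add_conj]
      simp only [Complex.add_re, Complex.ofReal_re]
      rw [← Complex.ofReal_pow, Complex.re_ofReal_mul]
    have hcr : -(ε * (‖m‖ * (‖c‖ * ‖x‖))) ≤ (starRingEnd ℂ c * kreinForm J m w).re := by
      have h1 := Complex.abs_re_le_norm (starRingEnd ℂ c * kreinForm J m w)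
      rw [norm_mul, Complex.norm_conj] at h1
      have h2 := mul_le_mul_of_nonneg_left (hmw m hm) (norm_nonneg c)
      have h3 := neg_abs_le (starRingEnd ℂ c * kreinForm J m w).re
      linarith
    have hvn : ‖m + c • w‖ ≤ ‖m‖ + (1 + ε) * (‖c‖ * ‖x‖) := by
      refine (norm_add_le _ _).trans ?_
      rw [norm_smul]
      nlinarith [mul_le_mul_of_nonneg_left hwn (norm_nonneg c)]
    have hsq : ‖m + c • w‖ ^ 2 ≤ (‖m‖ + (1 + ε) * (‖c‖ * ‖x‖)) ^ 2 :=
      pow_le_pow_left₀ (norm_nonneg _) hvn 2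
    have hcw := mul_le_mul_of_nonneg_left hww (sq_nonneg ‖c‖)
    have hm' := hεM m hm
    rw [hexp, div_mul_eq_mul_div, div_le_iff₀ (by positivity)]
    set a := ‖m‖
    set b := ‖c‖ * ‖x‖ with hb
    have hq : ε * ((a - b) ^ 2 + b ^ 2) ≤ (kreinForm J m m).re +
        2 * (starRingEnd ℂ c * kreinForm J m w).re + ‖c‖ ^ 2 * (kreinForm J w w).re := by
      have : ‖c‖ ^ 2 * (2 * ε * ‖x‖ ^ 2) = 2 * ε * b ^ 2 := by rw [hb]; ring
      nlinarith
    have hcs : (a + (1 + ε) * b) ^ 2 ≤ ((a - b) ^ 2 + b ^ 2) * (1 + (2 + ε) ^ 2) := by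
      nlinarith [sq_nonneg ((2 + ε) * (a - b) - b)]
    calc ε * ‖m + c • w‖ ^ 2 ≤ ε * (((a - b) ^ 2 + b ^ 2) * (1 + (2 + ε) ^ 2)) :=
          mul_le_mul_of_nonneg_left (hsq.trans hcs) hε.le
      _ = ε * ((a - b) ^ 2 + b ^ 2) * (1 + (2 + ε) ^ 2) := by ring
      _ ≤ _ := mul_le_mul_of_nonneg_right hq (by positivity)
  have hwM : w ∈ M := hM.le_of_ge hpos le_sup_left
    (Submodule.mem_sup_right (Submodule.mem_span_singleton_self w))
  have h0 := congrArg Complex.re (hx w hwM)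
  simp only [hw, kreinForm, map_add, map_smul, hJ.apply_apply, inner_add_right,
    inner_smul_right, Complex.add_re, Complex.re_ofReal_mul, hself, Complex.zero_re] at h0
  have h1 : (0 : ℝ) ≤ (inner ℂ x (J x) : ℂ).re := hxx
  have h2 : ‖x‖ ^ 2 ≤ 0 := by
    by_contra hcon
    push Not at hcon
    nlinarith
  have h3 : ‖x‖ = 0 := by nlinarith [norm_nonneg x, sq_nonneg ‖x‖]
  exact norm_eq_zero.1 h3

/-- `[g, g] - [h, h]` dominates a multiple of `(‖g‖ + ‖h‖)²` on a uniformly positive and a uniformly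
negative subspace, so a bound linear in `‖g‖ + ‖h‖` controls `g` and `h`. -/
theorem exists_norm_add_norm_le {M N : Submodule ℂ H} (hM : IsUniformlyPositive J M)
    (hN : IsUniformlyNegative J N) :
    ∃ C : ℝ, 0 < C ∧ ∀ g ∈ M, ∀ h ∈ N, ∀ t : ℝ, 0 ≤ t →
      (kreinForm J g g).re - (kreinForm J h h).re ≤ t * (‖g‖ + ‖h‖) → ‖g‖ + ‖h‖ ≤ C * t := by
  obtain ⟨α, hα, hαM⟩ := hM
  obtain ⟨β, hβ, hβN⟩ := hN
  refine ⟨2 / min α β, by positivity, fun g hg h hh t ht hle => ?_⟩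
  have hm : 0 < min α β := lt_min hα hβ
  have h1 := hαM g hg
  have h2 := hβN h hh
  have h3 : min α β * ‖g‖ ^ 2 ≤ α * ‖g‖ ^ 2 :=
    mul_le_mul_of_nonneg_right (min_le_left _ _) (sq_nonneg _)
  have h4 : min α β * ‖h‖ ^ 2 ≤ β * ‖h‖ ^ 2 :=
    mul_le_mul_of_nonneg_right (min_le_right _ _) (sq_nonneg _)
  rw [div_mul_eq_mul_div, le_div_iff₀ hm]
  set n := ‖g‖ + ‖h‖ with hn
  have hn0 : 0 ≤ n := by positivity
  rcases hn0.eq_or_lt with h0 | h0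
  · rw [← h0]; simpa using ht
  · refine le_of_mul_le_mul_right ?_ h0
    have h5 : n ^ 2 ≤ 2 * (‖g‖ ^ 2 + ‖h‖ ^ 2) := by nlinarith [sq_nonneg (‖g‖ - ‖h‖)]
    nlinarith [mul_le_mul_of_nonneg_left h5 hm.le]

/-- The sum is closed because `[g, g - h] + [g - h, h] = [g, g] - [h, h]` bounds `g` and `h` by
`g - h`; it is dense because a vector `J`-orthogonal to both subspaces is neither non-negative nor
non-positive unless it vanishes. -/
theorem exists_sub_eq_of_maximal [CompleteSpace H] (hJ : IsFundamentalSymmetry J)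
    {M N : Submodule ℂ H}
    (hM : Maximal (IsUniformlyPositive J) M) (hN : Maximal (IsUniformlyNegative J) N) (y : H) :
    ∃ g ∈ M, ∃ h ∈ N, g - h = y := by
  have hN' : Maximal (IsUniformlyPositive (-J)) N := by rwa [← isUniformlyNegative_eq]
  have : CompleteSpace M := (isClosed_of_maximal hM).completeSpace_coe
  have : CompleteSpace N := (isClosed_of_maximal hN').completeSpace_coe
  obtain ⟨C, hC, hCb⟩ := exists_norm_add_norm_le hM.prop hN.prop
  set Φ : M × N →L[ℂ] H := M.subtypeL.coprod (-N.subtypeL) with hΦ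
  have hΦa : ∀ v, Φ v = v.1 - v.2 := fun v => by simp [hΦ, sub_eq_add_neg]
  have hanti : AntilipschitzWith (Real.toNNReal C) Φ := by
    refine Φ.antilipschitz_of_bound fun v => ?_
    rw [Real.coe_toNNReal _ hC.le]
    have h1 := hCb v.1 v.1.2 v.2 v.2.2 ‖Φ v‖ (norm_nonneg _) (by
      have hid : (kreinForm J (v.1 : H) v.1).re - (kreinForm J (v.2 : H) v.2).re =
          (kreinForm J (v.1 : H) (Φ v)).re + (kreinForm J (Φ v) (v.2 : H)).re := by
        simp only [hΦa, kreinForm, map_sub, inner_sub_left, inner_sub_right, Complex.sub_re]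
        ring
      rw [hid, mul_add, mul_comm ‖Φ v‖ ‖(v.1 : H)‖]
      exact add_le_add ((Complex.re_le_norm _).trans (norm_kreinForm_le hJ _ _))
        ((Complex.re_le_norm _).trans (norm_kreinForm_le hJ _ _)))
    refine le_trans ?_ h1
    rw [Prod.norm_def]
    exact max_le (by simp) (by simp)
  have hcl : IsClosed (Φ.range : Set H) := by
    simpa [LinearMap.coe_range] using hanti.isClosed_range Φ.uniformContinuous
  have horth : Φ.rangeᗮ = ⊥ := by
    rw [Submodule.eq_bot_iff]
    intro w hw
    have hw' : ∀ v, inner ℂ (Φ v) w = (0 : ℂ) := fun v =>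
      (Submodule.mem_orthogonal _ _).1 hw _ ⟨v, rfl⟩
    have hM0 : ∀ m ∈ M, inner ℂ w m = (0 : ℂ) := fun m hm => by
      rw [inner_eq_zero_symm]; simpa [hΦa] using hw' (⟨m, hm⟩, 0)
    have hN0 : ∀ n ∈ N, inner ℂ w n = (0 : ℂ) := fun n hn => by
      rw [inner_eq_zero_symm]; simpa [hΦa] using hw' (0, ⟨n, hn⟩)
    have hJw : J w = 0 := by
      rcases le_total 0 (kreinForm J (J w) (J w)).re with h | h
      · refine eq_zero_of_orthogonal_of_maximal hJ hM (fun m hm => ?_) h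
        rw [kreinForm, hJ.inner_left, hJ.apply_apply]
        exact hM0 m hm
      · refine eq_zero_of_orthogonal_of_maximal hJ.neg hN' (fun m hm => ?_) ?_
        · simp only [kreinForm, neg_apply, inner_neg_right, neg_eq_zero]
          rw [hJ.inner_left, hJ.apply_apply]
          exact hN0 m hm
        · simpa [kreinForm] using h
    rw [← hJ.apply_apply w, hJw, map_zero]
  have htop := Submodule.topologicalClosure_eq_top_iff.2 horth
  rw [hcl.submodule_topologicalClosure_eq] at htop
  obtain ⟨v, hv⟩ := LinearMap.range_eq_top.1 htop y
  exact ⟨v.1, v.1.2, v.2, v.2.2, by rw [← hv]; exact (hΦa v).symm⟩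

theorem negIndex_eq_compl (J : H →L[ℂ] H) (f : ι → H) : negIndex J f = (posIndex J f)ᶜ := by
  ext i; simp [negIndex, posIndex]

/-- Vectors in the range of a synthesis operator define functionals that are bounded on
`{x | ∑ᵢ |⟨x, fᵢ⟩|² ≤ 1}`. -/
theorem exists_bound_of_mem_synthesisRange (hf : IsBessel f) {s : Set ι} {y : H}
    (hy : y ∈ synthesisRange f s) :
    ∃ C : ℝ, ∀ x : H, ∑' i, ‖inner ℂ (f i) x‖ ^ 2 ≤ 1 → ‖inner ℂ x y‖ ≤ C := by
  obtain ⟨c, hc⟩ := hy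
  obtain ⟨β, hβ⟩ := hf
  have hcs : Summable fun i => ‖c i‖ ^ 2 := by
    simpa using (memℓp_gen_iff (by norm_num)).1 (lp.memℓp c)
  refine ⟨∑' i, ‖c i‖ ^ 2 + 1, fun x hx => ?_⟩
  have hxs := (hβ x).1
  have hsum : HasSum (fun i : s => inner ℂ x (c i • f i)) (inner ℂ x y : ℂ) :=
    hc.mapL (innerSL ℂ x)
  have hle : ∀ i, ‖(inner ℂ x (c i • f i) : ℂ)‖ ≤ ‖c i‖ ^ 2 + ‖inner ℂ (f i) x‖ ^ 2 := fun i => by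
    rw [inner_smul_right, norm_mul, norm_inner_symm]
    nlinarith [sq_nonneg (‖c i‖ - ‖inner ℂ (f i) x‖), sq_nonneg ‖c i‖,
      sq_nonneg ‖inner ℂ (f i) x‖]
  have hS := hcs.add hxs
  have hS' : Summable fun i : s => ‖c i‖ ^ 2 + ‖inner ℂ (f i) x‖ ^ 2 := hS.subtype s
  rw [← hsum.tsum_eq]
  calc ‖∑' i : s, (inner ℂ x (c i • f i) : ℂ)‖
      ≤ ∑' i : s, (‖c i‖ ^ 2 + ‖inner ℂ (f i) x‖ ^ 2) :=
        tsum_of_norm_bounded hS'.hasSum fun i => hle i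
    _ ≤ ∑' i, (‖c i‖ ^ 2 + ‖inner ℂ (f i) x‖ ^ 2) :=
        hS.tsum_subtype_le _ s fun i => by positivity
    _ ≤ _ := by
        rw [hcs.tsum_add hxs]; linarith

/-- A `J`-frame is a frame: it has a lower frame bound. -/
theorem IsJFrame.exists_lower_bound [CompleteSpace H] (hJ : IsFundamentalSymmetry J)
    (hf : IsJFrame J f) :
    ∃ C : ℝ, 0 ≤ C ∧ ∀ x : H, ‖x‖ ^ 2 ≤ C * ∑' i, ‖inner ℂ (f i) x‖ ^ 2 := by
  obtain ⟨C, hC⟩ := banach_steinhaus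
    (g := fun x : {x : H // ∑' i, ‖inner ℂ (f i) x‖ ^ 2 ≤ 1} => innerSL ℂ (x : H)) (by
      intro y
      obtain ⟨g, hg, h, hh, rfl⟩ := exists_sub_eq_of_maximal hJ hf.maximal_pos hf.maximal_neg y
      obtain ⟨C₁, hC₁⟩ := exists_bound_of_mem_synthesisRange hf.isBessel hg
      obtain ⟨C₂, hC₂⟩ := exists_bound_of_mem_synthesisRange hf.isBessel hh
      refine ⟨C₁ + C₂, fun x => ?_⟩
      rw [innerSL_apply_apply, inner_sub_right]
      exact (norm_sub_le _ _).trans (add_le_add (hC₁ x x.2) (hC₂ x x.2)))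
  have hC' : ∀ x : H, ∑' i, ‖inner ℂ (f i) x‖ ^ 2 ≤ 1 → ‖x‖ ≤ C := fun x hx => by
    simpa using hC ⟨x, hx⟩
  refine ⟨C ^ 2, sq_nonneg _, fun x => ?_⟩
  set q := ∑' i, ‖inner ℂ (f i) x‖ ^ 2 with hq
  have hq0 : 0 ≤ q := tsum_nonneg fun i => sq_nonneg _
  have hscale : ∀ t : ℝ, 0 ≤ t → t ^ 2 * q ≤ 1 → t * ‖x‖ ≤ C := fun t ht htq => by
    have h1 := hC' ((t : ℂ) • x) (by
      simpa [inner_smul_right, mul_pow, tsum_mul_left, ← hq] using htq)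
    rwa [norm_smul, Complex.norm_real, Real.norm_of_nonneg ht] at h1
  have hC0 : 0 ≤ C := by simpa using hscale 0 le_rfl (by simp)
  rcases hq0.eq_or_lt with h0 | h0
  · -- Here every multiple of `x` is bounded by `C`.
    have hx0 : ‖x‖ = 0 := by
      by_contra hne
      have hp : 0 < ‖x‖ := lt_of_le_of_ne (norm_nonneg _) (Ne.symm hne)
      have h1 := hscale ((C + 1) / ‖x‖) (by positivity) (by rw [← h0]; simp)
      rw [div_mul_cancel₀ _ hne] at h1
      linarith
    rw [hx0, ← h0]; simp
  · have h1 := hscale (Real.sqrt q)⁻¹ (by positivity) (by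
      rw [inv_pow, Real.sq_sqrt hq0, inv_mul_cancel₀ h0.ne'])
    rw [inv_mul_le_iff₀ (Real.sqrt_pos.2 h0)] at h1
    calc ‖x‖ ^ 2 ≤ (Real.sqrt q * C) ^ 2 := pow_le_pow_left₀ (norm_nonneg _) h1 2
      _ = C ^ 2 * q := by rw [mul_pow, Real.sq_sqrt hq0]; ring

theorem IsJFrameOperator.kreinForm_symm [CompleteSpace H] (hJ : IsFundamentalSymmetry J)
    (hS : IsJFrameOperator J f S) (x y : H) : kreinForm J (S x) y = kreinForm J x (S y) := by
  have h1 : HasSum (fun i => indexSign J f i * kreinForm J x (f i) * kreinForm J (f i) y)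
      (kreinForm J (S x) y) := by
    simpa [kreinForm, inner_smul_right, mul_assoc] using (hS.hasSum x).mapL ((innerSL ℂ y).comp J)
  have h2 : HasSum (fun i => indexSign J f i * kreinForm J y (f i) * kreinForm J (f i) x)
      (kreinForm J (S y) x) := by
    simpa [kreinForm, inner_smul_right, mul_assoc] using (hS.hasSum y).mapL ((innerSL ℂ x).comp J)
  have h3 := h2.star
  rw [Complex.star_def, kreinForm_conj_symm hJ] at h3
  refine h1.unique ?_
  convert h3 using 2 with i
  have hsign : starRingEnd ℂ (indexSign J f i) = indexSign J f i := by
    unfold indexSign; split_ifs <;> simp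
  rw [map_mul, map_mul, hsign, kreinForm_conj_symm hJ, kreinForm_conj_symm hJ]
  ring

theorem hasSum_sq_kreinForm [CompleteSpace H] (hJ : IsFundamentalSymmetry J) {s : Set ι} {x g : H}
    (hg : HasSum (fun i : s => kreinForm J x (f i) • f i) g) :
    HasSum (fun i : s => ((‖inner ℂ (f i) (J x)‖ ^ 2 : ℝ) : ℂ)) (kreinForm J g x) := by
  have h1 : HasSum (fun i : s => kreinForm J x (f i) * kreinForm J (f i) x) (kreinForm J g x) := by
    simpa [kreinForm, inner_smul_right] using hg.mapL ((innerSL ℂ x).comp J)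
  convert h1 using 2 with i
  rw [← kreinForm_conj_symm hJ x (f i), Complex.mul_conj']
  simp [kreinForm]

/-- The splitting `S x = g - h` with `g = S₊ x` and `h = S₋ x`; the numbers `[g, x]` and `[h, x]`
are the two halves of `∑ᵢ |[x, fᵢ]|²`. -/
theorem IsJFrameOperator.exists_splitting [CompleteSpace H] (hJ : IsFundamentalSymmetry J)
    (hS : IsJFrameOperator J f S) (x : H) :
    ∃ g ∈ synthesisRange f (posIndex J f), ∃ h ∈ synthesisRange f (negIndex J f),
      ∃ a b : ℝ, S x = g - h ∧ 0 ≤ a ∧ 0 ≤ b ∧ kreinForm J g x = a ∧ kreinForm J h x = b ∧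
      ∑' i, ‖inner ℂ (f i) (J x)‖ ^ 2 = a + b := by
  obtain ⟨β, hβ⟩ := hS.isJFrame.isBessel
  have hx := (hβ (J x)).1
  let c : lp (fun _ : ι => ℂ) 2 :=
    ⟨fun i => kreinForm J x (f i), (memℓp_gen_iff (by norm_num)).2 (by simpa [kreinForm] using hx)⟩
  have hsum := hS.hasSum x
  have hpos : ∀ i : posIndex J f, indexSign J f i = 1 := fun i => if_pos i.2
  have hneg : ∀ i : negIndex J f, indexSign J f i = -1 := fun i =>
    if_neg (not_le.2 (show (kreinForm J (f i) (f i)).re < 0 from i.2))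
  have hcompl : IsCompl (posIndex J f) (negIndex J f) := by
    rw [negIndex_eq_compl]; exact isCompl_compl
  have hp : Summable fun i : posIndex J f => kreinForm J x (f i) • f i := by
    refine (hsum.summable.subtype (posIndex J f)).congr fun i => ?_
    simp only [Function.comp_apply]
    rw [hpos i, one_mul]
  have hn : Summable fun i : negIndex J f => kreinForm J x (f i) • f i := by
    refine (hsum.summable.subtype (negIndex J f)).neg.congr fun i => ?_
    simp only [Function.comp_apply]
    rw [hneg i, neg_one_mul, neg_smul, neg_neg]
  obtain ⟨g, hg⟩ := hp
  obtain ⟨h, hh⟩ := hn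
  have hgs := hasSum_sq_kreinForm hJ hg
  have hhs := hasSum_sq_kreinForm hJ hh
  have hga := (hx.subtype (posIndex J f)).hasSum
  have hhb := (hx.subtype (negIndex J f)).hasSum
  refine ⟨g, ⟨c, hg⟩, h, ⟨c, hh⟩, ∑' i : posIndex J f, ‖inner ℂ (f i) (J x)‖ ^ 2,
    ∑' i : negIndex J f, ‖inner ℂ (f i) (J x)‖ ^ 2, ?_, tsum_nonneg fun i => sq_nonneg _,
    tsum_nonneg fun i => sq_nonneg _, hgs.unique (Complex.hasSum_ofReal.2 hga),
    hhs.unique (Complex.hasSum_ofReal.2 hhb), ?_⟩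
  · refine hsum.unique ?_
    rw [sub_eq_add_neg]
    refine HasSum.add_isCompl (s := posIndex J f) (t := negIndex J f) hcompl ?_ ?_
    · convert hg using 2 with i
      simp only [Function.comp_apply]
      rw [hpos i, one_mul]
    · convert hh.neg using 2 with i
      simp only [Function.comp_apply]
      rw [hneg i, neg_one_mul, neg_smul]
  · exact (hga.add_isCompl hcompl hhb).tsum_eq

/-- For `u = S x - z x` and `S x = g - h` one has
`Re z · ([g, x] + [h, x]) = [g, g] - [h, h] - Re ([g, u] + [u, h])`. If `Re z ≤ 0`, this bounds
`g` and `h` by `u`, and the lower frame bound then bounds `x`. -/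
theorem IsJFrameOperator.exists_norm_le [CompleteSpace H] (hJ : IsFundamentalSymmetry J)
    (hS : IsJFrameOperator J f S) {z : ℂ} (hz : z.re ≤ 0) :
    ∃ C : ℝ, ∀ x, ‖x‖ ≤ C * ‖S x - z • x‖ := by
  obtain ⟨C₁, hC₁, h₁⟩ :=
    exists_norm_add_norm_le hS.isJFrame.maximal_pos.prop hS.isJFrame.maximal_neg.prop
  obtain ⟨C₂, hC₂, h₂⟩ := hS.isJFrame.exists_lower_bound hJ
  refine ⟨C₂ * C₁, fun x => ?_⟩
  obtain ⟨g, hg, h, hh, a, b, hSx, ha, hb, hga, hhb, hab⟩ := hS.exists_splitting hJ x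
  set u := S x - z • x with hu
  have hzx : z • x = g - h - u := by rw [hu, hSx]; abel
  have hxh : kreinForm J x h = b := by rw [← kreinForm_conj_symm hJ, hhb, Complex.conj_ofReal]
  have e1 : starRingEnd ℂ z * a = kreinForm J g g - kreinForm J g h - kreinForm J g u := by
    rw [← hga]
    have : starRingEnd ℂ z * kreinForm J g x = kreinForm J g (z • x) := by
      simp only [kreinForm, inner_smul_left]
    rw [this, hzx]
    simp only [kreinForm, inner_sub_left]
  have e2 : z * b = kreinForm J g h - kreinForm J h h - kreinForm J u h := by
    rw [← hxh]
    have : z * kreinForm J x h = kreinForm J (z • x) h := by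
      simp only [kreinForm, map_smul, inner_smul_right]
    rw [this, hzx]
    simp only [kreinForm, map_sub, inner_sub_right]
  have e3 := congrArg Complex.re e1
  have e4 := congrArg Complex.re e2
  simp only [Complex.re_mul_ofReal, Complex.conj_re, Complex.sub_re] at e3 e4
  have n1 := (Complex.re_le_norm _).trans (norm_kreinForm_le hJ g u)
  have n2 := (Complex.re_le_norm _).trans (norm_kreinForm_le hJ u h)
  have hgh : ‖g‖ + ‖h‖ ≤ C₁ * ‖u‖ := by
    refine h₁ g hg h hh ‖u‖ (norm_nonneg _) ?_
    nlinarith [mul_nonneg (neg_nonneg.2 hz) ha, mul_nonneg (neg_nonneg.2 hz) hb]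
  have h3 := h₂ (J x)
  rw [hab, hJ.norm_apply] at h3
  have ha' : a ≤ ‖g‖ * ‖x‖ := by
    have := (Complex.re_le_norm _).trans (norm_kreinForm_le hJ g x)
    rwa [hga, Complex.ofReal_re] at this
  have hb' : b ≤ ‖h‖ * ‖x‖ := by
    have := (Complex.re_le_norm _).trans (norm_kreinForm_le hJ h x)
    rwa [hhb, Complex.ofReal_re] at this
  rcases (norm_nonneg x).eq_or_lt with h0 | h0
  · rw [← h0]; positivity
  · refine le_of_mul_le_mul_right ?_ h0
    calc ‖x‖ * ‖x‖ = ‖x‖ ^ 2 := by ring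
      _ ≤ C₂ * (a + b) := h3
      _ ≤ C₂ * (C₁ * ‖u‖ * ‖x‖) := mul_le_mul_of_nonneg_left (by nlinarith) hC₂
      _ = _ := by ring

theorem IsJFrameOperator.re_pos_of_mem_spectrum [CompleteSpace H] (hJ : IsFundamentalSymmetry J)
    (hS : IsJFrameOperator J f S) {z : ℂ} (hz : z ∈ spectrum ℂ S) : 0 < z.re := by
  by_contra hcon
  exact notMem_spectrum_of_bounded_below hJ (hS.kreinForm_symm hJ)
    (hS.exists_norm_le hJ (not_lt.1 hcon))
    (hS.exists_norm_le hJ (by simpa using not_lt.1 hcon)) hz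

end FrameOperator

/-! ### Lower bounds for block operators and the spectral enclosure -/

section BlockOperator

variable {P : Type*} [NormedAddCommGroup P] [InnerProductSpace ℂ P]
variable {N : Type*} [NormedAddCommGroup N] [InnerProductSpace ℂ N]
variable {A : P →L[ℂ] P} {K : N →L[ℂ] P} {B D : N →L[ℂ] N} {a₁ a₂ d₁ d₂ b₁ b₂ : ℝ} {l : ℂ}

/-- By homogeneity, the lower bound for the defect passes from normalised numbers to vectors. -/
theorem exists_defect_lower_bound
    (hA : ∀ z : P, a₁ * ‖z‖ ^ 2 ≤ (inner ℂ z (A z) : ℂ).re ∧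
      (inner ℂ z (A z) : ℂ).re ≤ a₂ * ‖z‖ ^ 2)
    (hB : ∀ y : N, b₁ * ‖y‖ ^ 2 ≤ (inner ℂ y (B y) : ℂ).re ∧
      (inner ℂ y (B y) : ℂ).re ≤ b₂ * ‖y‖ ^ 2)
    (h : ∀ α β p r k s, IsGramData a₁ a₂ b₁ b₂ ‖K‖ α β p r k s →
      gramDefect l α β p r k s ≠ 0) :
    ∃ c : ℝ, 0 < c ∧ ∀ (z : P) (y : N), c * (‖z‖ ^ 2 + ‖y‖ ^ 2) ≤
      gramDefect l (inner ℂ z (A z) : ℂ).re (inner ℂ y (B y) : ℂ).re (‖z‖ ^ 2) (‖y‖ ^ 2)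
        (‖K y‖ ^ 2) (inner ℂ z (K y)) := by
  obtain ⟨c, hc, hcb⟩ := exists_gramDefect_lower_bound a₁ a₂ b₁ b₂ ‖K‖ l h
  refine ⟨c, hc, fun z y => ?_⟩
  have hn0 : 0 ≤ ‖z‖ ^ 2 + ‖y‖ ^ 2 := by positivity
  rcases hn0.eq_or_lt with h0 | h0
  · rw [← h0, mul_zero]; unfold gramDefect; positivity
  set n := ‖z‖ ^ 2 + ‖y‖ ^ 2 with hn
  have hi : 0 ≤ n⁻¹ := by positivity
  have hK : ‖K y‖ ^ 2 ≤ ‖K‖ ^ 2 * ‖y‖ ^ 2 := by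
    rw [← mul_pow]; exact pow_le_pow_left₀ (norm_nonneg _) (K.le_opNorm y) 2
  have hs : ‖(inner ℂ z (K y) : ℂ)‖ ^ 2 ≤ ‖z‖ ^ 2 * ‖K y‖ ^ 2 := by
    rw [← mul_pow]; exact pow_le_pow_left₀ (norm_nonneg _) (norm_inner_le_norm _ _) 2
  have key := hcb (n⁻¹ * (inner ℂ z (A z) : ℂ).re) (n⁻¹ * (inner ℂ y (B y) : ℂ).re)
    (n⁻¹ * ‖z‖ ^ 2) (n⁻¹ * ‖y‖ ^ 2) (n⁻¹ * ‖K y‖ ^ 2) ((n⁻¹ : ℝ) * inner ℂ z (K y))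
    { p_nonneg := by positivity
      r_nonneg := by positivity
      add_eq_one := by rw [← mul_add]; exact inv_mul_cancel₀ h0.ne'
      le_α := by rw [mul_left_comm]; exact mul_le_mul_of_nonneg_left (hA z).1 hi
      α_le := by rw [mul_left_comm]; exact mul_le_mul_of_nonneg_left (hA z).2 hi
      le_β := by rw [mul_left_comm]; exact mul_le_mul_of_nonneg_left (hB y).1 hi
      β_le := by rw [mul_left_comm]; exact mul_le_mul_of_nonneg_left (hB y).2 hi
      k_nonneg := by positivity
      k_le := by rw [mul_left_comm]; exact mul_le_mul_of_nonneg_left hK hi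
      norm_sq_le := by
        rw [norm_mul, mul_pow, Complex.norm_real, Real.norm_of_nonneg hi]
        calc n⁻¹ ^ 2 * ‖(inner ℂ z (K y) : ℂ)‖ ^ 2 ≤ n⁻¹ ^ 2 * (‖z‖ ^ 2 * ‖K y‖ ^ 2) :=
              mul_le_mul_of_nonneg_left hs (by positivity)
          _ = _ := by ring }
  have hhom : ∀ (t : ℝ), 0 ≤ t → ∀ (α β p r k : ℝ) (s : ℂ),
      gramDefect l (t * α) (t * β) (t * p) (t * r) (t * k) (t * s) =
        t * gramDefect l α β p r k s := by
    intro t ht α β p r k s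
    have e1 : ((t * α : ℝ) : ℂ) - l * (t * p : ℝ) - l * (t * s) =
        (t : ℂ) * ((α : ℂ) - l * p - l * s) := by push_cast; ring
    have e2 : ((t * β : ℝ) : ℂ) - l * (t * r - t * k : ℝ) + l * starRingEnd ℂ (t * s) =
        (t : ℂ) * ((β : ℂ) - l * (r - k : ℝ) + l * starRingEnd ℂ s) := by
      rw [map_mul, Complex.conj_ofReal]; push_cast; ring
    unfold gramDefect
    rw [e1, e2, norm_mul, norm_mul, Complex.norm_real, Real.norm_of_nonneg ht, mul_add]
  rw [hhom _ hi, le_inv_mul_iff₀ h0, mul_comm] at key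
  exact key

/-- In the coordinates `z = x - K y`, the equation `(S - l) (x, y) = (u, v)` reads
`(A - l) z - l K y = u`, `l K† z + (B - l (1 - K† K)) y = v - K† u` with `B = D + K† A K`. Tested
against `z` and `y` it controls the defect of the Gram numbers of `z` and `y`. -/
theorem exists_block_lower_bound [CompleteSpace P] [CompleteSpace N] (hAs : A.IsPositive)
    (hBs : (D + K† ∘L A ∘L K).IsPositive)
    (hA : HasClosedNumericalRange A a₁ a₂)
    (hB : HasClosedNumericalRange (D + K† ∘L A ∘L K) b₁ b₂)
    (hK : ‖K‖ < 1)
    (h : ∀ α β p r k s, IsGramData a₁ a₂ b₁ b₂ ‖K‖ α β p r k s →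
      gramDefect l α β p r k s ≠ 0) :
    ∃ C : ℝ, 0 ≤ C ∧ ∀ (x : P) (y : N), ‖x‖ + ‖y‖ ≤
      C * (‖A x - A (K y) - l • x‖ + ‖(K†) (A x) + D y - l • y‖) := by
  obtain ⟨c, hc, hcb⟩ := exists_defect_lower_bound hA.bounds hB.bounds h
  refine ⟨8 / c, by positivity, fun x y => ?_⟩
  set u := A x - A (K y) - l • x with hu
  set v := (K†) (A x) + D y - l • y with hv
  set z := x - K y with hz
  have hxz : x = z + K y := by rw [hz]; abel
  have hreA : ((inner ℂ z (A z) : ℂ).re : ℂ) = inner ℂ z (A z) :=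
    Complex.conj_eq_iff_re.1 (by rw [inner_conj_symm]; exact hAs.isSymmetric z z)
  have hreB : ((inner ℂ y ((D + K† ∘L A ∘L K) y) : ℂ).re : ℂ) =
      inner ℂ y ((D + K† ∘L A ∘L K) y) :=
    Complex.conj_eq_iff_re.1 (by rw [inner_conj_symm]; exact hBs.isSymmetric y y)
  have e1 : inner ℂ z u = ((inner ℂ z (A z) : ℂ).re : ℂ) - l * (‖z‖ ^ 2 : ℝ) -
      l * inner ℂ z (K y) := by
    rw [hreA, ← inner_self_eq_ofReal, hu, ← map_sub, ← hz]
    conv_lhs => rw [hxz]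
    simp only [inner_sub_right, inner_add_right, inner_smul_right]
    ring
  have e2 : inner ℂ y (v - (K†) u) = ((inner ℂ y ((D + K† ∘L A ∘L K) y) : ℂ).re : ℂ) -
      l * (‖y‖ ^ 2 - ‖K y‖ ^ 2 : ℝ) + l * starRingEnd ℂ (inner ℂ z (K y)) := by
    rw [hreB, Complex.ofReal_sub, ← inner_self_eq_ofReal, ← inner_self_eq_ofReal, hu, hv,
      inner_conj_symm]
    simp only [map_sub, map_smul, inner_sub_right, inner_add_right, inner_smul_right,
      ContinuousLinearMap.adjoint_inner_right, add_apply,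
      ContinuousLinearMap.comp_apply]
    rw [hxz]
    simp only [map_add, inner_add_right]
    ring
  have h1 := hcb z y
  unfold gramDefect at h1
  rw [← e1, ← e2] at h1
  have hKn : ‖(K†) u‖ ≤ ‖u‖ := by
    refine ((K†).le_opNorm u).trans (mul_le_of_le_one_left (norm_nonneg _) ?_)
    rw [LinearIsometryEquiv.norm_map]; exact hK.le
  have h2 : ‖(inner ℂ z u : ℂ)‖ ≤ ‖z‖ * ‖u‖ := norm_inner_le_norm _ _
  have h3 : ‖(inner ℂ y (v - (K†) u) : ℂ)‖ ≤ ‖y‖ * (‖u‖ + ‖v‖) :=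
    (norm_inner_le_norm _ _).trans (mul_le_mul_of_nonneg_left
      ((norm_sub_le _ _).trans (by linarith)) (norm_nonneg _))
  set m := ‖z‖ + ‖y‖ with hm
  have hz0 := norm_nonneg z
  have hy0 := norm_nonneg y
  have hu0 := norm_nonneg u
  have hv0 := norm_nonneg v
  have h4 : c * m ^ 2 ≤ 2 * m * (‖u‖ + ‖v‖) := by
    have h5 : m ^ 2 ≤ 2 * (‖z‖ ^ 2 + ‖y‖ ^ 2) := by rw [hm]; nlinarith [sq_nonneg (‖z‖ - ‖y‖)]
    have h6 := mul_le_mul_of_nonneg_left h5 hc.le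
    have h7 := mul_nonneg hz0 hv0
    rw [hm] at h6 ⊢
    linarith
  have h8 : c * m ≤ 2 * (‖u‖ + ‖v‖) := by
    have hm0 : 0 ≤ m := by positivity
    rcases hm0.eq_or_lt with h0 | h0
    · rw [← h0, mul_zero]; positivity
    · refine le_of_mul_le_mul_right ?_ h0
      linarith
  have h9 : ‖x‖ + ‖y‖ ≤ 2 * m := by
    have hKy : ‖K y‖ ≤ ‖y‖ := (K.le_opNorm y).trans (mul_le_of_le_one_left hy0 hK.le)
    have := norm_add_le z (K y)
    rw [← hxz] at this
    linarith
  rw [div_mul_eq_mul_div, le_div_iff₀ hc]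
  have h10 := mul_le_mul_of_nonneg_left h9 hc.le
  linarith

/-- To the right of both numerical ranges, `l - S` has coercive real part. -/
theorem exists_block_lower_bound_of_lt [CompleteSpace P] [CompleteSpace N]
    (hA : HasClosedNumericalRange A a₁ a₂) (hD : HasClosedNumericalRange D d₁ d₂)
    (hAs : A.IsPositive) (hlt : max a₂ d₂ < l.re) :
    ∃ C : ℝ, 0 ≤ C ∧ ∀ (x : P) (y : N), ‖x‖ + ‖y‖ ≤
      C * (‖A x - A (K y) - l • x‖ + ‖(K†) (A x) + D y - l • y‖) := by
  set c := l.re - max a₂ d₂ with hc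
  have hc0 : 0 < c := sub_pos.2 hlt
  refine ⟨2 / c, by positivity, fun x y => ?_⟩
  set u := A x - A (K y) - l • x with hu
  set v := (K†) (A x) + D y - l • y with hv
  have e1 : (inner ℂ x u : ℂ).re = (inner ℂ x (A x) : ℂ).re - (inner ℂ x (A (K y)) : ℂ).re -
      l.re * ‖x‖ ^ 2 := by
    rw [hu, inner_sub_right, inner_sub_right, inner_smul_right,
      inner_self_eq_ofReal, Complex.sub_re, Complex.sub_re, Complex.re_mul_ofReal]
  have e2 : (inner ℂ y v : ℂ).re = (inner ℂ x (A (K y)) : ℂ).re + (inner ℂ y (D y) : ℂ).re -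
      l.re * ‖y‖ ^ 2 := by
    have hsym : (inner ℂ (K y) (A x) : ℂ).re = (inner ℂ x (A (K y)) : ℂ).re := by
      rw [← hAs.isSymmetric.apply_clm, ← inner_conj_symm, Complex.conj_re]
    rw [hv, inner_sub_right, inner_add_right, inner_smul_right, inner_self_eq_ofReal,
      ContinuousLinearMap.adjoint_inner_right, Complex.sub_re, Complex.add_re, hsym,
      Complex.re_mul_ofReal]
  have h1 := (hA.bounds x).2
  have h2 := (hD.bounds y).2
  have h3 := mul_le_mul_of_nonneg_right (le_max_left a₂ d₂) (sq_nonneg ‖x‖)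
  have h4 := mul_le_mul_of_nonneg_right (le_max_right a₂ d₂) (sq_nonneg ‖y‖)
  have h5 : -(‖x‖ * ‖u‖) ≤ (inner ℂ x u : ℂ).re :=
    neg_le_of_abs_le ((Complex.abs_re_le_norm _).trans (norm_inner_le_norm _ _))
  have h6 : -(‖y‖ * ‖v‖) ≤ (inner ℂ y v : ℂ).re :=
    neg_le_of_abs_le ((Complex.abs_re_le_norm _).trans (norm_inner_le_norm _ _))
  have hx0 := norm_nonneg x
  have hy0 := norm_nonneg y
  have hu0 := norm_nonneg u
  have hv0 := norm_nonneg v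
  have h7 : c * (‖x‖ ^ 2 + ‖y‖ ^ 2) ≤ ‖x‖ * ‖u‖ + ‖y‖ * ‖v‖ := by
    have : c * (‖x‖ ^ 2 + ‖y‖ ^ 2) = l.re * ‖x‖ ^ 2 + l.re * ‖y‖ ^ 2 -
      max a₂ d₂ * ‖x‖ ^ 2 - max a₂ d₂ * ‖y‖ ^ 2 := by rw [hc]; ring
    linarith
  rw [div_mul_eq_mul_div, le_div_iff₀ hc0]
  set m := ‖x‖ + ‖y‖ with hm
  have hm0 : 0 ≤ m := by positivity
  rcases hm0.eq_or_lt with h0 | h0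
  · rw [← h0, zero_mul]; positivity
  · refine le_of_mul_le_mul_right ?_ h0
    have h8 : m ^ 2 ≤ 2 * (‖x‖ ^ 2 + ‖y‖ ^ 2) := by rw [hm]; nlinarith [sq_nonneg (‖x‖ - ‖y‖)]
    have h9 := mul_le_mul_of_nonneg_left h8 hc0.le
    have h10 := mul_nonneg hx0 hv0
    have h11 := mul_nonneg hy0 hu0
    rw [hm] at h9 ⊢
    linarith

/-- On the Hilbert space `P ⊕ N`, the block operator is symmetric with respect to the fundamental
symmetry `diag(1, -1)`, so lower bounds at `l` and `l̄` make `l` minus the block operator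
bijective. -/
theorem bijective_block [CompleteSpace P] [CompleteSpace N] (hAs : IsSelfAdjoint A)
    (hDs : IsSelfAdjoint D)
    (h₁ : ∃ C : ℝ, 0 ≤ C ∧ ∀ (x : P) (y : N), ‖x‖ + ‖y‖ ≤
      C * (‖A x - A (K y) - l • x‖ + ‖(K†) (A x) + D y - l • y‖))
    (h₂ : ∃ C : ℝ, 0 ≤ C ∧ ∀ (x : P) (y : N), ‖x‖ + ‖y‖ ≤
      C * (‖A x - A (K y) - starRingEnd ℂ l • x‖ +
        ‖(K†) (A x) + D y - starRingEnd ℂ l • y‖)) :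
    Function.Bijective fun w : P × N =>
      (l • w.1 - (A w.1 - A (K w.2)), l • w.2 - ((K†) (A w.1) + D w.2)) := by
  let e := WithLp.prodContinuousLinearEquiv 2 ℂ P N
  let fstE : WithLp 2 (P × N) →L[ℂ] P := (ContinuousLinearMap.fst ℂ P N).comp (e : _ →L[ℂ] P × N)
  let sndE : WithLp 2 (P × N) →L[ℂ] N := (ContinuousLinearMap.snd ℂ P N).comp (e : _ →L[ℂ] P × N)
  let J₀ : WithLp 2 (P × N) →L[ℂ] WithLp 2 (P × N) :=
    (e.symm : P × N →L[ℂ] _).comp (fstE.prod (-sndE))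
  let T : WithLp 2 (P × N) →L[ℂ] WithLp 2 (P × N) :=
    (e.symm : P × N →L[ℂ] _).comp
      ((A.comp fstE - (A.comp K).comp sndE).prod (((K†).comp A).comp fstE + D.comp sndE))
  have hT1 : ∀ w, (T w).fst = A w.fst - A (K w.snd) := fun w => rfl
  have hT2 : ∀ w, (T w).snd = (K†) (A w.fst) + D w.snd := fun w => rfl
  have hJ1 : ∀ w, (J₀ w).fst = w.fst := fun w => rfl
  have hJ2 : ∀ w, (J₀ w).snd = -w.snd := fun w => rfl
  have hA' : ∀ x y : P, (inner ℂ (A x) y : ℂ) = inner ℂ x (A y) := hAs.isSymmetric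
  have hD' : ∀ x y : N, (inner ℂ (D x) y : ℂ) = inner ℂ x (D y) := hDs.isSymmetric
  have hJ₀ : IsFundamentalSymmetry J₀ := by
    constructor
    · rw [ContinuousLinearMap.isSelfAdjoint_iff_isSymmetric]
      intro v w
      change inner ℂ (J₀ v) w = inner ℂ v (J₀ w)
      simp only [WithLp.prod_inner_apply]
      change inner ℂ (J₀ v).fst w.fst + inner ℂ (J₀ v).snd w.snd =
        inner ℂ v.fst (J₀ w).fst + inner ℂ v.snd (J₀ w).snd
      simp [hJ1, hJ2]
    · ext w
      change J₀ (J₀ w) = w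
      refine WithLp.ofLp_injective 2 (Prod.ext ?_ ?_)
      · rfl
      · exact neg_neg _
  have hTs : ∀ v w, kreinForm J₀ (T v) w = kreinForm J₀ v (T w) := by
    intro v w
    simp only [kreinForm, WithLp.prod_inner_apply]
    change inner ℂ w.fst (J₀ (T v)).fst + inner ℂ w.snd (J₀ (T v)).snd =
      inner ℂ (T w).fst (J₀ v).fst + inner ℂ (T w).snd (J₀ v).snd
    simp only [hJ1, hJ2, hT1, hT2, inner_sub_left, inner_sub_right, inner_add_left,
      inner_add_right, inner_neg_right, ContinuousLinearMap.adjoint_inner_left,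
      ContinuousLinearMap.adjoint_inner_right, hA', hD']
    ring
  have hbound : ∀ t : ℂ, (∃ C : ℝ, 0 ≤ C ∧ ∀ (x : P) (y : N), ‖x‖ + ‖y‖ ≤
      C * (‖A x - A (K y) - t • x‖ + ‖(K†) (A x) + D y - t • y‖)) →
      ∃ C : ℝ, ∀ w, ‖w‖ ≤ C * ‖T w - t • w‖ := by
    rintro t ⟨C, hC, hCb⟩
    refine ⟨C * 2, fun w => ?_⟩
    have hle : ∀ w : WithLp 2 (P × N), ‖w‖ ≤ ‖w.fst‖ + ‖w.snd‖ := fun w => by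
      refine le_of_sq_le_sq ?_ (by positivity)
      rw [WithLp.prod_norm_sq_eq_of_L2]
      nlinarith [norm_nonneg w.fst, norm_nonneg w.snd]
    have hfst : ∀ w : WithLp 2 (P × N), ‖w.fst‖ ≤ ‖w‖ := fun w => by
      refine le_of_sq_le_sq ?_ (norm_nonneg _)
      rw [WithLp.prod_norm_sq_eq_of_L2]
      nlinarith [sq_nonneg ‖w.snd‖]
    have hsnd : ∀ w : WithLp 2 (P × N), ‖w.snd‖ ≤ ‖w‖ := fun w => by
      refine le_of_sq_le_sq ?_ (norm_nonneg _)
      rw [WithLp.prod_norm_sq_eq_of_L2]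
      nlinarith [sq_nonneg ‖w.fst‖]
    have h3 := hfst (T w - t • w)
    have h4 := hsnd (T w - t • w)
    calc ‖w‖ ≤ ‖w.fst‖ + ‖w.snd‖ := hle w
      _ ≤ C * (‖(T w - t • w).fst‖ + ‖(T w - t • w).snd‖) := hCb w.fst w.snd
      _ ≤ C * (‖T w - t • w‖ + ‖T w - t • w‖) := mul_le_mul_of_nonneg_left (by linarith) hC
      _ = _ := by ring
  have hnot := notMem_spectrum_of_bounded_below hJ₀ hTs (hbound l h₁) (hbound _ h₂)
  rw [spectrum.notMem_iff, ContinuousLinearMap.isUnit_iff_bijective] at hnot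
  have hcomp := (e.bijective.comp hnot).comp e.symm.bijective
  convert hcomp using 1
  funext w
  simp only [Function.comp_apply, sub_apply, Algebra.algebraMap_eq_smul_one]
  rfl

end BlockOperator

section Spectrum
variable {H : Type*} [NormedAddCommGroup H] [InnerProductSpace ℂ H] [CompleteSpace H]
variable {P : Type*} [NormedAddCommGroup P] [InnerProductSpace ℂ P] [CompleteSpace P]
variable {N : Type*} [NormedAddCommGroup N] [InnerProductSpace ℂ N] [CompleteSpace N]
variable {A : P →L[ℂ] P} {K : N →L[ℂ] P} {D : N →L[ℂ] N} {a₁ a₂ d₁ d₂ b₁ b₂ : ℝ}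

/-- The spectral enclosure for an operator that is similar to a block operator matrix
`[A, -A K; K† A, D]`. -/
theorem spectrum_subset_of_block (S : H →L[ℂ] H) (e : H ≃ₗ[ℂ] P × N)
    (hfst : ∀ x, (e (S x)).1 = A (e x).1 - A (K (e x).2))
    (hsnd : ∀ x, (e (S x)).2 = (K†) (A (e x).1) + D (e x).2)
    (hApos : UniformlyPositiveOp A) (hK : ‖K‖ < 1) (hDs : IsSelfAdjoint D)
    (hBpos : UniformlyPositiveOp (D + K† ∘L A ∘L K))
    (hA : HasClosedNumericalRange A a₁ a₂) (hD : HasClosedNumericalRange D d₁ d₂)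
    (hB : HasClosedNumericalRange (D + K† ∘L A ∘L K) b₁ b₂) :
    spectrum ℂ S \ Set.range Complex.ofReal ⊆ {z : ℂ | ‖z - a₂‖ < a₂ ∧ b₁ / 2 < z.re} ∧
    spectrum ℂ S ∩ Set.range Complex.ofReal ⊆
      Complex.ofReal '' Set.Icc (min a₁ b₁) (max a₂ d₂) := by
  have hnot : ∀ l : ℂ, (∃ C : ℝ, 0 ≤ C ∧ ∀ (x : P) (y : N), ‖x‖ + ‖y‖ ≤
        C * (‖A x - A (K y) - l • x‖ + ‖(K†) (A x) + D y - l • y‖)) →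
      (∃ C : ℝ, 0 ≤ C ∧ ∀ (x : P) (y : N), ‖x‖ + ‖y‖ ≤
        C * (‖A x - A (K y) - starRingEnd ℂ l • x‖ +
          ‖(K†) (A x) + D y - starRingEnd ℂ l • y‖)) → l ∉ spectrum ℂ S := by
    intro l h₁ h₂
    have hb := bijective_block hApos.1.isSelfAdjoint hDs h₁ h₂
    rw [spectrum.notMem_iff, ContinuousLinearMap.isUnit_iff_bijective]
    have hcomp := (e.symm.bijective.comp hb).comp e.bijective
    convert hcomp using 1
    funext x
    apply e.injective
    simp only [Function.comp_apply, LinearEquiv.apply_symm_apply]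
    refine Prod.ext ?_ ?_
    · simp [Algebra.algebraMap_eq_smul_one, hfst]
    · simp [Algebra.algebraMap_eq_smul_one, hsnd]
  have ha1 := hA.pos hApos
  have hb1 := hB.pos hBpos
  constructor
  · rintro l ⟨hl, hlR⟩
    have him : l.im ≠ 0 := fun h0 => hlR ⟨l.re, Complex.ext rfl (by simp [h0])⟩
    by_contra hcon
    refine hnot l ?_ ?_ hl
    · exact exists_block_lower_bound hApos.1 hBpos.1 hA hB hK fun α β p r k s hG h0 =>
        hcon (hG.of_im_ne_zero ha1 hb1 (norm_nonneg _) hK him h0)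
    · refine exists_block_lower_bound hApos.1 hBpos.1 hA hB hK fun α β p r k s hG h0 => hcon ?_
      -- The enclosing region is symmetric with respect to the real axis.
      have h1 := hG.of_im_ne_zero ha1 hb1 (norm_nonneg _) hK (by simpa using him) h0
      have h2 : starRingEnd ℂ l - a₂ = starRingEnd ℂ (l - a₂) := by simp
      rw [h2, Complex.norm_conj, Complex.conj_re] at h1
      exact h1
  · rintro _ ⟨hl, t, rfl⟩
    refine ⟨t, ⟨?_, ?_⟩, rfl⟩
    · by_contra hcon
      have h1 := exists_block_lower_bound (l := (t : ℂ)) hApos.1 hBpos.1 hA hB hK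
        fun α β p r k s hG h0 =>
          hcon (by simpa using hG.min_le_re hb1 (norm_nonneg _) hK (Complex.ofReal_im t) h0)
      exact hnot t h1 (by rwa [Complex.conj_ofReal]) hl
    · by_contra hcon
      have h1 := exists_block_lower_bound_of_lt (K := K) (l := (t : ℂ)) hA hD hApos.1
        (by simpa using hcon)
      exact hnot t h1 (by rwa [Complex.conj_ofReal]) hl

end Spectrum

end KreinFrame

end

theorem theorem5p1
    {H : Type*} [NormedAddCommGroup H] [InnerProductSpace ℂ H] [CompleteSpace H]
    (J : H →L[ℂ] H) (hJ : KreinFrame.IsFundamentalSymmetry J)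
    {ι : Type*} (f : ι → H) (S : H →L[ℂ] H) (hS : KreinFrame.IsJFrameOperator J f S) :
    (∀ (P : Type*) [NormedAddCommGroup P] [InnerProductSpace ℂ P] [CompleteSpace P]
        (N : Type*) [NormedAddCommGroup N] [InnerProductSpace ℂ N] [CompleteSpace N]
        (F : KreinFrame.FundamentalDecomposition J P N)
        (A : P →L[ℂ] P) (K : N →L[ℂ] P) (D : N →L[ℂ] N) (a₁ a₂ d₁ d₂ b₁ b₂ : ℝ),
        KreinFrame.IsFirstBlockForm F S A K D →
        KreinFrame.HasClosedNumericalRange A a₁ a₂ →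
        KreinFrame.HasClosedNumericalRange D d₁ d₂ →
        KreinFrame.HasClosedNumericalRange (D + K† ∘L A ∘L K) b₁ b₂ →
        spectrum ℂ S \ Set.range Complex.ofReal ⊆ {z : ℂ | ‖z - a₂‖ < a₂ ∧ b₁ / 2 < z.re} ∧
        spectrum ℂ S ∩ Set.range Complex.ofReal ⊆
          Complex.ofReal '' Set.Icc (min a₁ b₁) (max a₂ d₂)) ∧
    (∀ (P : Type*) [NormedAddCommGroup P] [InnerProductSpace ℂ P] [CompleteSpace P]
        (N : Type*) [NormedAddCommGroup N] [InnerProductSpace ℂ N] [CompleteSpace N]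
        (F : KreinFrame.FundamentalDecomposition J P N)
        (A : P →L[ℂ] P) (L : N →L[ℂ] P) (D : N →L[ℂ] N) (a₁ a₂ d₁ d₂ b₁ b₂ : ℝ),
        KreinFrame.IsSecondBlockForm F S A L D →
        KreinFrame.HasClosedNumericalRange A a₁ a₂ →
        KreinFrame.HasClosedNumericalRange D d₁ d₂ →
        KreinFrame.HasClosedNumericalRange (A + L ∘L D ∘L L†) b₁ b₂ →
        spectrum ℂ S \ Set.range Complex.ofReal ⊆ {z : ℂ | ‖z - d₂‖ < d₂ ∧ b₁ / 2 < z.re} ∧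
        spectrum ℂ S ∩ Set.range Complex.ofReal ⊆
          Complex.ofReal '' Set.Icc (min d₁ b₁) (max a₂ d₂)) ∧
    spectrum ℂ S ⊆ {z : ℂ | 0 < z.re} := by
  refine ⟨?_, ?_, fun z hz => hS.re_pos_of_mem_spectrum hJ hz⟩
  · intro P _ _ _ N _ _ _ F A K D a₁ a₂ d₁ d₂ b₁ b₂ h hA hD hB
    exact KreinFrame.spectrum_subset_of_block S F.equiv h.fst_eq h.snd_eq h.pos h.norm_lt_one
      h.isSelfAdjoint h.schur_pos hA hD hB
  · -- Exchanging the two summands turns the second block form into the first one, with the roles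
    -- of `A` and `D` interchanged and `K = L†`.
    intro P _ _ _ N _ _ _ F A L D a₁ a₂ d₁ d₂ b₁ b₂ h hA hD hB
    have hB' : A + (L†)† ∘L D ∘L L† = A + L ∘L D ∘L L† := by
      rw [ContinuousLinearMap.adjoint_adjoint]
    rw [max_comm]
    refine KreinFrame.spectrum_subset_of_block (A := D) (K := L†) (D := A) S
      (F.equiv.trans (LinearEquiv.prodComm ℂ P N)) (fun x => ?_) (fun x => ?_) h.pos
      (by rw [LinearIsometryEquiv.norm_map]; exact h.norm_lt_one) h.isSelfAdjoint
      (hB' ▸ h.schur_pos) hD hA (hB' ▸ hB)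
    · simp [h.snd_eq, sub_eq_neg_add]
    · simp [h.fst_eq, add_comm]
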